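/- Let $0\le\nu<1$, let $p\ge2$ be an integer, and let $a\in\mathbb{C}\setminus\{0\}$ with $|\arg a|<\frac12\pi$ (principal values of logarithms and powers throughout). Let $K_\nu$ be the modified Bessel function of the second kind. Write $\zeta$ for the Riemann zeta function, $\psi=\Gamma'/\Gamma$, $\gamma$ for Euler's constant, and $x!=\Gamma(1+x)$. Put $\nu_*=1/(2p)$ and $$\mathcal H_{\nu,p}(a)=\begin{cases}\dfrac12\Gamma(\nu)\big(\tfrac a2\big)^{-2\nu}\zeta(2p\nu)+\dfrac1{4p}\Gamma\big(\tfrac1{2p}\big)\Gamma\big(\tfrac1{2p}-\nu\big)\big(\tfrac a2\big)^{-1/p}+\dfrac{\pi}{4\,\Gamma(1+\nu)\sin\pi\nu}&(\nu\ne0,\nu_*),\\[2ex]\dfrac1{4p}\Gamma\big(\tfrac1{2p}\big)^2\big(\tfrac a2\big)^{-1/p}+\dfrac12\big\{\gamma+\log\tfrac a2-p\log2\pi\big\}&(\nu=0),\\[2ex]\dfrac1{4p}\Gamma\big(\tfrac1{2p}\big)\big(\tfrac a2\big)^{-1/p}\big\{\psi\big(\tfrac1{2p}\big)-2\log\tfrac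 a2+(2p-1)\gamma\big\}+\dfrac{\pi}{4\,\Gamma(1+\frac1{2p})\sin(\pi/(2p))}&(\nu=\nu_*).\end{cases}$$ For each integer $k\ge1$ let $N_k\ge1$ be an arbitrary integer and let $0<c_k<1$, where in addition $c_k<1-\nu$ if $N_k=1$. Set $$R_k(a;N_k)=-\frac{\pi}{4\pi i}\int_{-c_k+N_k-\nu-\infty i}^{-c_k+N_k-\nu+\infty i}\frac{\Gamma(1+2ps)}{\Gamma(1+s)\,\Gamma(1+s+\nu)}\Big(\frac{a}{2(2\pi k)^p}\Big)^{2s}\frac{\sin\pi ps}{\sin\pi s\,\sin\pi(s+\nu)}\,ds,$$ the integral being along a vertical line. Then this integral converges absolutely for every $k\ge 1$, both the series over $n\ge1$ defining the left-hand side below and the series over $k\ge1$ on its right-hand side converge absolutely, and $$\sum_{n\ge1}\big(\tfrac12an^p\big)^{-\nu}K_\nu(an^p)=\mathcal H_{\nu,p}(a)+\sum_{k\ge1}\frac1k\bigg\{\frac{\sin\pi p\nu}{2\sin\pi\nu}\sum_{n=1}^{N_k-1}(-1)^{pn}\,\frac{(2p(n-\nu))!}{n!\,(n-\nu)!}\Big(\frac{a}{2(2\pi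 k)^p}\Big)^{2n-2\nu}+R_k(a;N_k)\bigg\},$$ where $\sin(\pi p\nu)/\sin(\pi\nu)$ is read as its limit $p$ when $\nu=0$. -/

import Mathlib

open Complex MeasureTheory Set

noncomputable section

/-- The modified Bessel function of the second kind `K_ν(z)` of real order `ν`, on the half-plane
`Re z > 0`, given by `K_ν(z) = ∫_0^∞ exp(-z cosh t) cosh(ν t) dt`. -/
def besselK (ν : ℝ) (z : ℂ) : ℂ :=
  ∫ t in Ioi (0 : ℝ), Complex.exp (-z * (Real.cosh t : ℂ)) * (Real.cosh (ν * t) : ℂ)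

/-- The `n`-th term `(a n^p / 2)^{-ν} K_ν(a n^p)` of the sum `S_{ν,p}(a)`. -/
def besselTerm (ν : ℝ) (p : ℕ) (a : ℂ) (n : ℕ) : ℂ :=
  (a * (n : ℂ) ^ p / 2) ^ (-(ν : ℂ)) * besselK ν (a * (n : ℂ) ^ p)

/-- The sum `S_{ν,p}(a)`, taken over `n ≥ 1`. -/
def besselSum (ν : ℝ) (p : ℕ) (a : ℂ) : ℂ := ∑' n : ℕ, besselTerm ν p a (n + 1)

/-- The residue part `H_{ν,p}(a)`. -/
def residuePart (ν : ℝ) (p : ℕ) (a : ℂ) : ℂ :=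
  if ν = 0 then
    1 / (4 * p) * Complex.Gamma (1 / (2 * p)) ^ 2 * (a / 2) ^ (-(1 / p) : ℂ)
      + 1 / 2 * ((Real.eulerMascheroniConstant : ℂ) + Complex.log (a / 2)
          - p * (Real.log (2 * Real.pi) : ℂ))
  else if ν = 1 / (2 * p) then
    1 / (4 * p) * Complex.Gamma (1 / (2 * p)) * (a / 2) ^ (-(1 / p) : ℂ)
        * (Complex.digamma (1 / (2 * p)) - 2 * Complex.log (a / 2)
            + (2 * p - 1) * (Real.eulerMascheroniConstant : ℂ))
      + Real.pi / Complex.sin (Real.pi / (2 * p)) / (4 * Complex.Gamma (1 + 1 / (2 * p)))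
  else
    1 / 2 * Complex.Gamma ν * (a / 2) ^ (-2 * ν : ℂ) * riemannZeta (2 * p * ν)
      + 1 / (4 * p) * Complex.Gamma (1 / (2 * p)) * Complex.Gamma (1 / (2 * p) - ν)
          * (a / 2) ^ (-(1 / p) : ℂ)
      + Real.pi / Complex.sin (Real.pi * ν) / (4 * Complex.Gamma (1 + ν))

/-- The quotient `sin(π p ν) / sin(π ν)`, with its limiting value `p` at `ν = 0`. -/
def sinRatio (ν : ℝ) (p : ℕ) : ℂ :=
  if ν = 0 then p else Complex.sin (Real.pi * p * ν) / Complex.sin (Real.pi * ν)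

/-- The finite series of the `k`-th component, truncated at index `N`: the sum over
`1 ≤ n ≤ N - 1`, where `x! = Γ(1 + x)` for non-integer `x`. -/
def componentSeries (ν : ℝ) (p : ℕ) (a : ℂ) (k N : ℕ) : ℂ :=
  sinRatio ν p / 2 * ∑ n ∈ Finset.Ico 1 N,
    (-1 : ℂ) ^ (p * n)
      * (Complex.Gamma (1 + 2 * p * (n - ν)) / (n.factorial * Complex.Gamma (1 + (n - ν))))
      * (a / (2 * (2 * Real.pi * k) ^ p)) ^ (2 * n - 2 * ν : ℂ)

/-- The integrand of the Mellin-Barnes integral for the remainder. -/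
def remainderIntegrand (ν : ℝ) (p : ℕ) (a : ℂ) (k : ℕ) (s : ℂ) : ℂ :=
  Complex.Gamma (1 + 2 * p * s) / (Complex.Gamma (1 + s) * Complex.Gamma (1 + s + ν))
    * (a / (2 * (2 * Real.pi * k) ^ p)) ^ (2 * s)
    * (Complex.sin (Real.pi * p * s)
        / (Complex.sin (Real.pi * s) * Complex.sin (Real.pi * (s + ν))))

/-- The point with ordinate `t` on the vertical path `Re s = -c + N - ν`. -/
def pathPoint (ν : ℝ) (N : ℕ) (c t : ℝ) : ℂ := ((-c + N - ν : ℝ) : ℂ) + t * Complex.I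

/-- The remainder `R_k(a; N)`: `-π / (4 π i)` times the integral of `remainderIntegrand` along the
upward vertical line `Re s = -c + N - ν`, on which `ds = i dt`. -/
def remainder (ν : ℝ) (p : ℕ) (a : ℂ) (k N : ℕ) (c : ℝ) : ℂ :=
  -(Real.pi / (4 * Real.pi * Complex.I))
    * ∫ t : ℝ, remainderIntegrand ν p a k (pathPoint ν N c t) * Complex.I

end

noncomputable section

/-! The argument is Mellin–Barnes. For `Re z > 0` the function `(z/2)^(-ν) K_ν(z)` is `1/(4πi)`
times the integral of `Γ(s) Γ(s-ν) (z/2)^(-2s)` along a line to the right of `0` and `ν`. Since `ν <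
1` and `2p > 1`, the line `Re s = 1` serves for `z = a n^p` and allows summation over `n`, which
replaces the factors `n^(-2ps)` by `ζ(2ps)` (`hasSum_besselTerm`).

Moving the line to `Re s = -A` with `0 < A < 1-ν` crosses the poles `0`, `ν` and `1/(2p)` only.
Their residues make up the residue part; its exceptional cases are those where two of these poles
merge into a double one (`integral_barnesMain_eq_residuePart`). On the new line the functional
equation of `ζ` turns `ζ(-2ps)` into a multiple of `ζ(1+2ps)`, whose Dirichlet series splits the
integral into components indexed by `k` (`barnesMain_neg`, `hasSum_component_integral`).

Finally the line `Re s = A` of each component is moved to `Re s = -c+N-ν`. The zeros of `sin πps`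
cancel those of `sin πs`, so only the simple poles `n-ν`, `1 ≤ n < N`, are crossed, and they produce
the finite series (`componentSeries_add_remainder`). Thus the truncation may be chosen separately
for each `k` without altering the terms.

All shifts rest on exponential decay in strips: up to an arbitrarily small loss `Γ` decays at rate
`π/2`, `ζ` grows subexponentially, and the power of `a` grows at rate at most `2|arg a| < π`. Both
integrands therefore decay at rate at least `π/2 - |arg a|`. The shift theorem itself is
`integral_vertical_sub_integral_vertical`. -/

/-! ### The Gamma integral with complex rate -/

lemma integrableOn_rpow_mul_exp_neg_mul {σ b : ℝ} (hσ : 0 < σ) (hb : 0 < b) :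
    IntegrableOn (fun t : ℝ => t ^ (σ - 1) * Real.exp (-(b * t))) (Ioi 0) := by
  have := integrableOn_rpow_mul_exp_neg_mul_rpow (p := 1) (s := σ - 1) (by linarith) one_pos hb
  simpa using this

lemma norm_cpow_mul_exp_neg_mul {a r : ℂ} {t : ℝ} (ht : 0 < t) :
    ‖(t : ℂ) ^ (a - 1) * Complex.exp (-(r * t))‖ = t ^ (a.re - 1) * Real.exp (-(r.re * t)) := by
  rw [norm_mul, norm_cpow_eq_rpow_re_of_pos ht, Complex.norm_exp]
  simp

lemma aestronglyMeasurable_cpow_mul_exp_neg_mul (a r : ℂ) :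
    AEStronglyMeasurable (fun t : ℝ => (t : ℂ) ^ (a - 1) * Complex.exp (-(r * t)))
      (volume.restrict (Ioi 0)) := by
  refine ContinuousOn.aestronglyMeasurable (fun t ht => ContinuousAt.continuousWithinAt ?_)
    measurableSet_Ioi
  refine ContinuousAt.mul ?_ (by fun_prop)
  exact (continuousAt_ofReal_cpow_const t (a - 1) (Or.inr (ne_of_gt ht)))

lemma integrableOn_cpow_mul_exp_neg_mul {a r : ℂ} (ha : 0 < a.re) (hr : 0 < r.re) :
    IntegrableOn (fun t : ℝ => (t : ℂ) ^ (a - 1) * Complex.exp (-(r * t))) (Ioi 0) := by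
  refine Integrable.mono' (integrableOn_rpow_mul_exp_neg_mul ha hr)
    (aestronglyMeasurable_cpow_mul_exp_neg_mul a r) ?_
  filter_upwards [ae_restrict_mem measurableSet_Ioi] with t ht
  rw [norm_cpow_mul_exp_neg_mul ht]

lemma differentiableOn_integral_cpow_mul_exp_neg_mul {a : ℂ} (ha : 0 < a.re) :
    DifferentiableOn ℂ
      (fun r : ℂ => ∫ t in Ioi (0 : ℝ), (t : ℂ) ^ (a - 1) * Complex.exp (-(r * t)))
      {r | 0 < r.re} := by
  intro r hr
  have hr : 0 < r.re := hr
  refine DifferentiableAt.differentiableWithinAt ?_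
  have hs : {w : ℂ | r.re / 2 < w.re} ∈ nhds r :=
    (isOpen_lt continuous_const Complex.continuous_re).mem_nhds (by simp; linarith)
  -- Near `r` the real part stays above `Re r / 2`, which gives the rate of the dominating function;
  -- differentiation brings down a factor `t`, hence the exponent `Re a + 1 - 1`.
  refine (hasDerivAt_integral_of_dominated_loc_of_deriv_le
    (μ := volume.restrict (Ioi (0 : ℝ)))
    (F := fun (r : ℂ) (t : ℝ) => (t : ℂ) ^ (a - 1) * Complex.exp (-(r * t)))
    (F' := fun (r : ℂ) (t : ℝ) => (t : ℂ) ^ (a - 1) * (Complex.exp (-(r * t)) * (-t)))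
    (bound := fun t => t ^ (a.re + 1 - 1) * Real.exp (-(r.re / 2 * t))) hs
    (Filter.Eventually.of_forall fun w => aestronglyMeasurable_cpow_mul_exp_neg_mul a w)
    (integrableOn_cpow_mul_exp_neg_mul ha hr) ?_ ?_
    (integrableOn_rpow_mul_exp_neg_mul (by linarith) (by linarith)) ?_).2.differentiableAt
  · refine ((aestronglyMeasurable_cpow_mul_exp_neg_mul a r).mul
      (g := fun t : ℝ => (-(t : ℂ))) (by fun_prop)).congr ?_
    filter_upwards with t
    simp only [Pi.mul_apply]
    ring
  · filter_upwards [ae_restrict_mem measurableSet_Ioi] with t ht w hw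
    have ht : 0 < t := ht
    rw [← mul_assoc, norm_mul, norm_cpow_mul_exp_neg_mul ht]
    simp only [norm_neg, Complex.norm_real, Real.norm_eq_abs, abs_of_pos ht]
    have h1 : t ^ (a.re + 1 - 1) = t ^ (a.re - 1) * t := by
      rw [show a.re + 1 - 1 = (a.re - 1) + 1 by ring, Real.rpow_add_one ht.ne']
    rw [h1]
    have hw : r.re / 2 < w.re := hw
    have : Real.exp (-(w.re * t)) ≤ Real.exp (-(r.re / 2 * t)) := by
      gcongr
    calc _ = t ^ (a.re - 1) * t * Real.exp (-(w.re * t)) := by ring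
      _ ≤ _ := by gcongr
  · filter_upwards with t w _
    have h : HasDerivAt (fun w : ℂ => -(w * (t : ℂ))) (-(t : ℂ)) w := by
      simpa using ((hasDerivAt_id w).mul_const (t : ℂ)).fun_neg
    exact (h.cexp).const_mul _

/-- The Gamma integral `∫ t ^ (a - 1) e ^ (-r t)` for complex `r` with positive real part. -/
lemma integral_cpow_mul_exp_neg_complex_mul {a r : ℂ} (ha : 0 < a.re) (hr : 0 < r.re) :
    ∫ t in Ioi (0 : ℝ), (t : ℂ) ^ (a - 1) * Complex.exp (-(r * t)) = r ^ (-a) * Complex.Gamma a := by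
  have hU : IsOpen {r : ℂ | 0 < r.re} := isOpen_lt continuous_const Complex.continuous_re
  have h1 := (differentiableOn_integral_cpow_mul_exp_neg_mul ha).analyticOnNhd hU
  have h2 : DifferentiableOn ℂ (fun r : ℂ => r ^ (-a) * Complex.Gamma a) {r | 0 < r.re} := by
    intro r hr
    refine DifferentiableAt.differentiableWithinAt (DifferentiableAt.mul_const ?_ _)
    exact differentiableAt_id.cpow_const (Or.inl hr)
  have hpre : IsPreconnected {r : ℂ | 0 < r.re} := (convex_halfSpace_re_gt 0).isPreconnected
  -- Both sides are holomorphic in the right half-plane and agree on the positive reals, which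
  -- accumulate at `1`.
  refine h1.eqOn_of_preconnected_of_frequently_eq (h2.analyticOnNhd hU) hpre
    (z₀ := 1) (by simp) ?_ hr
  have hreal : ∀ x : ℝ, 0 < x → (∫ t in Ioi (0 : ℝ), (t : ℂ) ^ (a - 1) *
      Complex.exp (-((x : ℂ) * t))) = (x : ℂ) ^ (-a) * Complex.Gamma a := by
    intro x hx
    rw [integral_cpow_mul_exp_neg_mul_Ioi ha hx, one_div, ← ofReal_inv, cpow_neg, ofReal_inv,
      inv_cpow _ _ (by rw [arg_ofReal_of_nonneg hx.le]; exact Real.pi_pos.ne)]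
  have ht : Filter.Tendsto (fun x : ℝ => (x : ℂ)) (nhdsWithin 1 {1}ᶜ) (nhdsWithin 1 {1}ᶜ) := by
    refine tendsto_nhdsWithin_iff.2 ⟨?_, ?_⟩
    · exact (Complex.continuous_ofReal.tendsto' 1 1 (by simp)).mono_left nhdsWithin_le_nhds
    · filter_upwards [self_mem_nhdsWithin] with x hx
      simpa using hx
  refine ht.frequently ?_
  refine Filter.Eventually.frequently ?_
  have : ∀ᶠ x : ℝ in nhds 1, 0 < x := lt_mem_nhds one_pos
  filter_upwards [nhdsWithin_le_nhds this] with x hx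
  exact hreal x hx

/-! ### Exponential bounds in vertical strips: Gamma, powers, sine and cosine -/

/-- `f` is `O(exp (κ |Im s|))` on the part `|Im s| ≥ 1` of the closed strip `A ≤ Re s ≤ B`. -/
def StripBound (f : ℂ → ℂ) (A B κ : ℝ) : Prop :=
  ∃ C : ℝ, 0 ≤ C ∧ ∀ s : ℂ, A ≤ s.re → s.re ≤ B → 1 ≤ |s.im| → ‖f s‖ ≤ C * Real.exp (κ * |s.im|)

/-- Rates add, so the decay of a product is read off from its factors. The restriction `|Im s| ≥ 1`
keeps real poles out of every estimate. -/
lemma StripBound.mul {f g : ℂ → ℂ} {A B κ₁ κ₂ : ℝ} (hf : StripBound f A B κ₁)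
    (hg : StripBound g A B κ₂) : StripBound (fun s => f s * g s) A B (κ₁ + κ₂) := by
  obtain ⟨C, hC, h⟩ := hf
  obtain ⟨D, hD, h'⟩ := hg
  refine ⟨C * D, mul_nonneg hC hD, fun s h1 h2 h3 => ?_⟩
  rw [norm_mul, add_mul, Real.exp_add]
  calc _ ≤ (C * Real.exp (κ₁ * |s.im|)) * (D * Real.exp (κ₂ * |s.im|)) := by
        gcongr
        · exact h s h1 h2 h3
        · exact h' s h1 h2 h3
    _ = _ := by ring

lemma StripBound.congr {f g : ℂ → ℂ} {A B κ : ℝ} (hf : StripBound f A B κ)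
    (h : ∀ s : ℂ, A ≤ s.re → s.re ≤ B → 1 ≤ |s.im| → g s = f s) : StripBound g A B κ := by
  obtain ⟨C, hC, h'⟩ := hf
  exact ⟨C, hC, fun s h1 h2 h3 => by rw [h s h1 h2 h3]; exact h' s h1 h2 h3⟩

lemma StripBound.mono {f : ℂ → ℂ} {A B A' B' κ κ' : ℝ} (hf : StripBound f A B κ)
    (hA : A ≤ A') (hB : B' ≤ B) (hκ : κ ≤ κ') : StripBound f A' B' κ' := by
  obtain ⟨C, hC, h'⟩ := hf
  refine ⟨C, hC, fun s h1 h2 h3 => (h' s (hA.trans h1) (h2.trans hB) h3).trans ?_⟩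
  gcongr

/-- Composition with a real affine map `s ↦ m s + w`, `|m| ≥ 1`. -/
lemma StripBound.comp_affine {f : ℂ → ℂ} {A B A' B' κ m w : ℝ} (hf : StripBound f A' B' κ)
    (hm : 1 ≤ |m|) (h : ∀ x, A ≤ x → x ≤ B → A' ≤ m * x + w ∧ m * x + w ≤ B') :
    StripBound (fun s => f (m * s + w)) A B (κ * |m|) := by
  obtain ⟨C, hC, h'⟩ := hf
  refine ⟨C, hC, fun s h1 h2 h3 => ?_⟩
  have hre : ((m : ℂ) * s + w).re = m * s.re + w := by simp
  have him : ((m : ℂ) * s + w).im = m * s.im := by simp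
  -- The condition `|m| ≥ 1` is what preserves `|Im| ≥ 1` under the affine map.
  have := h' (m * s + w) (by rw [hre]; exact (h _ h1 h2).1) (by rw [hre]; exact (h _ h1 h2).2)
    (by rw [him, abs_mul]; nlinarith)
  rwa [him, abs_mul, ← mul_assoc] at this

lemma StripBound.const_mul {f : ℂ → ℂ} {A B κ : ℝ} (c : ℂ) (hf : StripBound f A B κ) :
    StripBound (fun s => c * f s) A B κ := by
  obtain ⟨C, hC, h'⟩ := hf
  refine ⟨‖c‖ * C, by positivity, fun s h1 h2 h3 => ?_⟩
  rw [norm_mul, mul_assoc]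
  gcongr
  exact h' s h1 h2 h3

/-- Take the Gamma integral with rate `r = e^(iβ)`. The factor `r^(-s)` has modulus `e^(β Im s)`,
and taking absolute values under the integral leaves a real Gamma integral of rate `cos β`. -/
lemma norm_Gamma_mul_exp_le {s : ℂ} (hs : 0 < s.re) {β : ℝ} (hβ : |β| < Real.pi / 2) :
    ‖Complex.Gamma s‖ * Real.exp (β * s.im) ≤ Real.Gamma s.re * (Real.cos β) ^ (-s.re) := by
  obtain ⟨hb1, hb2⟩ := abs_lt.1 hβ
  have hcos : 0 < Real.cos β := Real.cos_pos_of_mem_Ioo ⟨by linarith, hb2⟩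
  set r : ℂ := Complex.exp (β * I) with hr
  have hrre : r.re = Real.cos β := by rw [hr, Complex.exp_ofReal_mul_I_re]
  have harg : r.arg = β := by
    rw [hr, Complex.exp_mul_I, Complex.arg_cos_add_sin_mul_I ⟨by linarith, by linarith⟩]
  have hnorm : ‖r‖ = 1 := by rw [hr, Complex.norm_exp_ofReal_mul_I]
  have h0 : r ≠ 0 := Complex.exp_ne_zero _
  have key := integral_cpow_mul_exp_neg_complex_mul hs (r := r) (by rw [hrre]; exact hcos)
  have h1 : ‖r ^ (-s) * Complex.Gamma s‖ = ‖Complex.Gamma s‖ * Real.exp (β * s.im) := by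
    rw [norm_mul, Complex.norm_cpow_of_ne_zero h0, hnorm, harg]
    simp only [neg_re, Real.one_rpow, neg_im, mul_neg, Real.exp_neg, one_div, inv_inv]
    ring
  rw [← h1, ← key]
  refine (norm_integral_le_integral_norm _).trans (le_of_eq ?_)
  rw [setIntegral_congr_fun measurableSet_Ioi
    (fun t ht => norm_cpow_mul_exp_neg_mul (a := s) (r := r) ht), hrre,
    Real.integral_rpow_mul_exp_neg_mul_Ioi hs hcos, one_div, Real.inv_rpow hcos.le,
    Real.rpow_neg hcos.le, mul_comm]

/-- The rotated bound is applied with the sign of `β` matching that of `Im s`; its right-hand side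
is continuous in `Re s`, hence bounded on `[A, B]`. -/
lemma stripBound_Gamma_of_pos {A B β : ℝ} (hA : 0 < A) (hβ0 : 0 ≤ β) (hβ : β < Real.pi / 2) :
    StripBound Complex.Gamma A B (-β) := by
  have hcos : 0 < Real.cos β := Real.cos_pos_of_mem_Ioo ⟨by linarith, hβ⟩
  have hcont : ContinuousOn (fun σ : ℝ => Real.Gamma σ * (Real.cos β) ^ (-σ)) (Icc A B) := by
    intro σ hσ
    refine ContinuousAt.continuousWithinAt (ContinuousAt.mul ?_ ?_)
    · refine (Real.differentiableAt_Gamma fun m => ?_).continuousAt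
      have := hσ.1
      have : (0 : ℝ) ≤ m := Nat.cast_nonneg m
      linarith
    · exact (Real.continuousAt_const_rpow hcos.ne').comp continuous_neg.continuousAt
  obtain ⟨C, hC⟩ := isCompact_Icc.exists_bound_of_continuousOn hcont
  refine ⟨max C 0, le_max_right _ _, fun s h1 h2 h3 => ?_⟩
  have hs : 0 < s.re := by linarith
  have hb : ‖Complex.Gamma s‖ * Real.exp (β * |s.im|) ≤ max C 0 := by
    refine le_trans ?_ ((le_abs_self _).trans ((hC s.re ⟨h1, h2⟩).trans (le_max_left _ _)))
    rcases abs_cases s.im with ⟨h, _⟩ | ⟨h, _⟩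
    · rw [h]
      exact norm_Gamma_mul_exp_le hs (by rw [abs_of_nonneg hβ0]; exact hβ)
    · have := norm_Gamma_mul_exp_le hs (β := -β) (by rw [abs_neg, abs_of_nonneg hβ0]; exact hβ)
      rwa [Real.cos_neg, neg_mul_comm, ← h] at this
  rw [neg_mul, Real.exp_neg, ← div_eq_mul_inv, le_div_iff₀ (Real.exp_pos _)]
  exact hb

/-- Exponential decay of `Γ` on vertical strips, with any rate below `π / 2`. -/
lemma stripBound_Gamma (A B : ℝ) {β : ℝ} (hβ0 : 0 ≤ β) (hβ : β < Real.pi / 2) :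
    StripBound Complex.Gamma A B (-β) := by
  -- Induction on how far the strip reaches to the left: `Γ(s) = Γ(s+1)/s`, and `|s| ≥ 1` makes the
  -- division harmless.
  have key : ∀ n : ℕ, ∀ A B : ℝ, -(n : ℝ) < A → StripBound Complex.Gamma A B (-β) := by
    intro n
    induction n with
    | zero => intro A B h; exact stripBound_Gamma_of_pos (by simpa using h) hβ0 hβ
    | succ n ih =>
      intro A B h
      obtain ⟨C, hC, h'⟩ := ih (A + 1) (B + 1) (by push_cast at h; linarith)
      refine ⟨C, hC, fun s h1 h2 h3 => ?_⟩
      have hs0 : s ≠ 0 := by rintro rfl; norm_num at h3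
      have hn : 1 ≤ ‖s‖ := h3.trans (Complex.abs_im_le_norm s)
      have := h' (s + 1) (by simpa using h1) (by simpa using h2) (by simpa using h3)
      rw [Complex.Gamma_add_one s hs0, norm_mul] at this
      simp only [add_im, one_im, add_zero] at this
      exact (le_mul_of_one_le_left (norm_nonneg _) hn).trans this
  obtain ⟨n, hn⟩ := exists_nat_gt (-A)
  exact key n A B (by linarith)

lemma stripBound_cpow {x : ℂ} (hx : x ≠ 0) (A B m : ℝ) :
    StripBound (fun s => x ^ ((m : ℂ) * s)) A B (|m| * |x.arg|) := by
  have hx' : 0 < ‖x‖ := norm_pos_iff.2 hx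
  have hcont : ContinuousOn (fun σ : ℝ => ‖x‖ ^ (m * σ)) (Icc A B) :=
    (Continuous.rpow continuous_const (by fun_prop) (fun _ => Or.inl hx'.ne')).continuousOn
  obtain ⟨C, hC⟩ := isCompact_Icc.exists_bound_of_continuousOn hcont
  refine ⟨max C 0, le_max_right _ _, fun s h1 h2 h3 => ?_⟩
  rw [Complex.norm_cpow_of_ne_zero hx, div_eq_mul_inv, ← Real.exp_neg]
  have e1 : ((m : ℂ) * s).re = m * s.re := by simp
  have e2 : ((m : ℂ) * s).im = m * s.im := by simp
  rw [e1, e2]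
  gcongr
  · exact (le_abs_self _).trans ((hC s.re ⟨h1, h2⟩).trans (le_max_left _ _))
  · calc -(x.arg * (m * s.im)) ≤ |x.arg * (m * s.im)| := neg_le_abs _
      _ = _ := by rw [abs_mul, abs_mul]; ring

lemma norm_exp_mul_I_le (z : ℂ) : ‖Complex.exp (z * I)‖ ≤ Real.exp |z.im| := by
  rw [Complex.norm_exp]
  simp only [mul_re, I_re, mul_zero, I_im, mul_one, zero_sub]
  exact Real.exp_le_exp.2 (neg_le_abs _)

lemma norm_sin_le_exp (z : ℂ) : ‖Complex.sin z‖ ≤ Real.exp |z.im| := by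
  rw [Complex.sin, norm_div, norm_mul, Complex.norm_I, mul_one, Complex.norm_ofNat,
    div_le_iff₀ two_pos]
  refine (norm_sub_le _ _).trans ?_
  have h1 := norm_exp_mul_I_le z
  have h2 := norm_exp_mul_I_le (-z)
  rw [neg_im, abs_neg] at h2
  linarith

lemma norm_cos_le_exp (z : ℂ) : ‖Complex.cos z‖ ≤ Real.exp |z.im| := by
  rw [Complex.cos, norm_div, Complex.norm_ofNat, div_le_iff₀ two_pos]
  refine (norm_add_le _ _).trans ?_
  have h1 := norm_exp_mul_I_le z
  have h2 := norm_exp_mul_I_le (-z)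
  rw [neg_im, abs_neg] at h2
  linarith

lemma stripBound_sin (A B m : ℝ) :
    StripBound (fun s => Complex.sin ((m : ℂ) * s)) A B |m| := by
  refine ⟨1, zero_le_one, fun s _ _ _ => (norm_sin_le_exp _).trans (le_of_eq ?_)⟩
  simp [abs_mul]

lemma stripBound_cos (A B m : ℝ) :
    StripBound (fun s => Complex.cos ((m : ℂ) * s)) A B |m| := by
  refine ⟨1, zero_le_one, fun s _ _ _ => (norm_cos_le_exp _).trans (le_of_eq ?_)⟩
  simp [abs_mul]

/-! ### Growth of the zeta function in vertical strips -/

lemma hasDerivAt_ofReal_cpow_const_of_pos {x : ℝ} (hx : 0 < x) (w : ℂ) :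
    HasDerivAt (fun y : ℝ => (y : ℂ) ^ w) (w * (x : ℂ) ^ (w - 1)) x := by
  have h := (hasDerivAt_id (x : ℂ)).cpow_const (c := w) (Or.inl (by simpa using hx))
  simpa using h.comp_ofReal

/-- The Euler–Maclaurin type correction terms of `(s - 1) ζ(s)`. -/
def zetaCorrection (n : ℕ) (s : ℂ) : ℂ :=
  (s - 1) * ((n + 1 : ℝ) : ℂ) ^ (-s) + ((n + 1 + 1 : ℝ) : ℂ) ^ (1 - s) - ((n + 1 : ℝ) : ℂ) ^ (1 - s)

/-- With `m = n+1`, the term is the increment over `[m, m+1]` of `y ↦ (s-1) m^(-s) y + y^(1-s)`. Its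
derivative `(s-1)(m^(-s) - y^(-s))` is small by a second use of the mean value inequality. The gain
of one power of `m` makes the series converge for `Re s > 0`. -/
lemma norm_zetaCorrection_le (n : ℕ) {s : ℂ} (hs : 0 < s.re) :
    ‖zetaCorrection n s‖ ≤ ‖s - 1‖ * ‖s‖ * (n + 1 : ℝ) ^ (-s.re - 1) := by
  set m : ℝ := n + 1 with hm
  have hm0 : 0 < m := by positivity
  have h1 : ∀ x ∈ Icc m (m + 1), ‖(x : ℂ) ^ (-s) - (m : ℂ) ^ (-s)‖ ≤ ‖s‖ * m ^ (-s.re - 1) := by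
    intro x hx
    have := Convex.norm_image_sub_le_of_norm_hasDerivWithin_le
      (f := fun y : ℝ => (y : ℂ) ^ (-s)) (f' := fun y => -s * (y : ℂ) ^ (-s - 1))
      (C := ‖s‖ * m ^ (-s.re - 1)) (s := Icc m (m + 1)) (x := m) (y := x)
      (fun y hy => (hasDerivAt_ofReal_cpow_const_of_pos (hm0.trans_le hy.1) (-s)).hasDerivWithinAt)
      (fun y hy => ?_) (convex_Icc _ _) ⟨le_refl _, by linarith⟩ hx
    · refine this.trans ?_
      have : ‖x - m‖ ≤ 1 := by
        rw [Real.norm_eq_abs, abs_of_nonneg (by linarith [hx.1])]; linarith [hx.2]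
      exact mul_le_of_le_one_right (by positivity) this
    · have hy0 : 0 < y := hm0.trans_le hy.1
      rw [norm_mul, norm_neg, norm_cpow_eq_rpow_re_of_pos hy0]
      have : (-s - 1).re = -s.re - 1 := by simp
      rw [this]
      gcongr ‖s‖ * ?_
      exact Real.rpow_le_rpow_of_nonpos hm0 hy.1 (by linarith)
  have h2 := Convex.norm_image_sub_le_of_norm_hasDerivWithin_le
      (f := fun y : ℝ => (s - 1) * (m : ℂ) ^ (-s) * (y : ℂ) + (y : ℂ) ^ (1 - s))
      (f' := fun y => (s - 1) * (m : ℂ) ^ (-s) * 1 + (1 - s) * (y : ℂ) ^ (1 - s - 1))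
      (C := ‖s - 1‖ * (‖s‖ * m ^ (-s.re - 1))) (s := Icc m (m + 1)) (x := m) (y := m + 1)
      (fun y hy => (((hasDerivAt_id (y : ℂ)).comp_ofReal.const_mul _).add
        (hasDerivAt_ofReal_cpow_const_of_pos (hm0.trans_le hy.1) (1 - s))).hasDerivWithinAt)
      (fun y hy => ?_) (convex_Icc _ _) ⟨le_refl _, by linarith⟩ ⟨by linarith, le_refl _⟩
  · have e : zetaCorrection n s = ((s - 1) * (m : ℂ) ^ (-s) * ((m + 1 : ℝ) : ℂ) +
        ((m + 1 : ℝ) : ℂ) ^ (1 - s)) - ((s - 1) * (m : ℂ) ^ (-s) * (m : ℂ) + (m : ℂ) ^ (1 - s)) := by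
      rw [zetaCorrection, show ((n + 1 + 1 : ℝ) : ℂ) = ((m + 1 : ℝ) : ℂ) from rfl,
        show ((n + 1 : ℝ) : ℂ) = (m : ℂ) from rfl, ofReal_add m 1, ofReal_one]
      ring
    rw [e]
    refine h2.trans (le_of_eq ?_)
    simp
    ring
  · have e : (s - 1) * (m : ℂ) ^ (-s) * 1 + (1 - s) * (y : ℂ) ^ (1 - s - 1)
        = -((s - 1) * ((y : ℂ) ^ (-s) - (m : ℂ) ^ (-s))) := by
      rw [show 1 - s - 1 = -s by ring]; ring
    rw [e, norm_neg, norm_mul]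
    gcongr
    exact h1 y hy

lemma summable_succ_rpow_neg {x : ℝ} (hx : 1 < x) : Summable fun n : ℕ => (n + 1 : ℝ) ^ (-x) := by
  have := (summable_nat_add_iff 1).2 (Real.summable_nat_rpow (p := -x) |>.2 (by linarith))
  simpa using this

/-- The correction terms are those of `(s-1) ζ(s)` plus a telescoping series with sum `-1`. -/
lemma riemannZeta₁_eq_of_one_lt_re {s : ℂ} (hs : 1 < s.re) :
    riemannZeta₁ s = 1 + ∑' n, zetaCorrection n s := by
  have hs1 : s ≠ 1 := by rintro rfl; simp at hs
  have hsum : Summable fun n => zetaCorrection n s := by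
    refine Summable.of_norm_bounded
      ((summable_succ_rpow_neg (x := s.re + 1) (by linarith)).mul_left (‖s - 1‖ * ‖s‖))
      fun n => ?_
    have := norm_zetaCorrection_le n (s := s) (by linarith)
    rwa [show -s.re - 1 = -(s.re + 1) by ring] at this
  have hz : HasSum (fun n : ℕ => (s - 1) * ((n + 1 : ℝ) : ℂ) ^ (-s)) ((s - 1) * riemannZeta s) := by
    rw [zeta_eq_tsum_one_div_nat_add_one_cpow hs]
    refine HasSum.mul_left _ ?_
    have h := (summable_nat_add_iff 1).2 (Complex.summable_one_div_nat_cpow.2 hs)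
    have e1 : (fun n : ℕ => 1 / ((n + 1 : ℕ) : ℂ) ^ s)
        = fun n : ℕ => ((n + 1 : ℝ) : ℂ) ^ (-s) := by
      ext n; push_cast; rw [cpow_neg, one_div]
    have e2 : (fun n : ℕ => 1 / ((n : ℂ) + 1) ^ s) = fun n : ℕ => ((n + 1 : ℝ) : ℂ) ^ (-s) := by
      ext n; push_cast; rw [cpow_neg, one_div]
    rw [e2]
    rw [e1] at h
    exact h.hasSum
  have ht : HasSum (fun n : ℕ => ((n + 1 + 1 : ℝ) : ℂ) ^ (1 - s) - ((n + 1 : ℝ) : ℂ) ^ (1 - s))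
      (-1) := by
    have h := hsum.sub hz.summable
    have h' : Summable
        (fun n : ℕ => ((n + 1 + 1 : ℝ) : ℂ) ^ (1 - s) - ((n + 1 : ℝ) : ℂ) ^ (1 - s)) := by
      refine h.congr fun n => ?_
      rw [zetaCorrection]; ring
    have hl := h'.hasSum.tendsto_sum_nat
    have hl' : Filter.Tendsto (fun N : ℕ => ∑ n ∈ Finset.range N,
        (((n + 1 + 1 : ℝ) : ℂ) ^ (1 - s) - ((n + 1 : ℝ) : ℂ) ^ (1 - s))) Filter.atTop
        (nhds (-1)) := by
      have e : ∀ N : ℕ, ∑ n ∈ Finset.range N,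
          (((n + 1 + 1 : ℝ) : ℂ) ^ (1 - s) - ((n + 1 : ℝ) : ℂ) ^ (1 - s))
          = ((N + 1 : ℝ) : ℂ) ^ (1 - s) - 1 := by
        intro N
        have := Finset.sum_range_sub (fun n : ℕ => ((n + 1 : ℝ) : ℂ) ^ (1 - s)) N
        simpa using this
      simp_rw [e]
      have : Filter.Tendsto (fun N : ℕ => ((N + 1 : ℝ) : ℂ) ^ (1 - s)) Filter.atTop (nhds 0) := by
        rw [tendsto_zero_iff_norm_tendsto_zero]
        have h3 : Filter.Tendsto (fun N : ℕ => (N + 1 : ℝ) ^ (-(s.re - 1))) Filter.atTop (nhds 0) :=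
          (tendsto_rpow_neg_atTop (by linarith)).comp
            (Filter.tendsto_atTop_add_const_right _ _ tendsto_natCast_atTop_atTop)
        refine h3.congr fun N => ?_
        rw [norm_cpow_eq_rpow_re_of_pos (by positivity)]
        congr 1
        simp
      simpa using this.sub_const 1
    rw [← tendsto_nhds_unique hl hl']
    exact h'.hasSum
  have htot := hz.add ht
  have e : (∑' n, zetaCorrection n s) = (s - 1) * riemannZeta s + -1 := by
    rw [← htot.tsum_eq]
    congr 1
    ext n
    rw [zetaCorrection]; ring
  rw [e, riemannZeta_eq_inv_sub_mul hs1]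
  field_simp [sub_ne_zero.2 hs1]
  ring

/-- Continuation by the identity theorem. The domain is bounded because the term bound contains
`‖s-1‖ ‖s‖`, lies in `Re z > 1/4` so that the exponent `-5/4` gives a summable majorant, and is
large enough to contain both `s` and `2`. -/
lemma riemannZeta₁_eq_of_half_le_re {s : ℂ} (hs : 1 / 2 ≤ s.re) :
    riemannZeta₁ s = 1 + ∑' n, zetaCorrection n s := by
  set R : ℝ := ‖s‖ + 3
  set U : Set ℂ := {z | 1 / 4 < z.re} ∩ Metric.ball 0 R with hU
  have hUo : IsOpen U :=
    (isOpen_lt continuous_const Complex.continuous_re).inter Metric.isOpen_ball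
  have hUc : IsPreconnected U :=
    ((convex_halfSpace_re_gt (1 / 4)).inter (convex_ball 0 R)).isPreconnected
  have hd : DifferentiableOn ℂ (fun z => 1 + ∑' n, zetaCorrection n z) U := by
    refine DifferentiableOn.const_add _ ?_
    refine differentiableOn_tsum_of_summable_norm
      (u := fun n : ℕ => (R + 1) * R * (n + 1 : ℝ) ^ (-(5 / 4) : ℝ))
      ((summable_succ_rpow_neg (by norm_num)).mul_left _) (fun n => ?_) hUo ?_
    · unfold zetaCorrection
      have h0 : ((n + 1 : ℝ) : ℂ) ≠ 0 := by exact_mod_cast (by positivity : (n + 1 : ℝ) ≠ 0)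
      have h1 : ((n + 1 + 1 : ℝ) : ℂ) ≠ 0 := by exact_mod_cast (by positivity : (n + 1 + 1 : ℝ) ≠ 0)
      intro z _
      refine DifferentiableAt.differentiableWithinAt ?_
      refine DifferentiableAt.sub (DifferentiableAt.add ?_ ?_) ?_
      · exact (by fun_prop : DifferentiableAt ℂ (fun z : ℂ => z - 1) z).mul
          (DifferentiableAt.const_cpow (by fun_prop) (Or.inl h0))
      · exact DifferentiableAt.const_cpow (by fun_prop) (Or.inl h1)
      · exact DifferentiableAt.const_cpow (by fun_prop) (Or.inl h0)
    · rintro n w ⟨hw1, hw2⟩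
      have hw1 : 1 / 4 < w.re := hw1
      have hw2 : ‖w‖ < R := by simpa using hw2
      refine (norm_zetaCorrection_le n (by linarith)).trans ?_
      gcongr
      · exact (norm_sub_le _ _).trans (by simp; linarith)
      · have : (0 : ℝ) ≤ n := Nat.cast_nonneg n
        linarith
      · linarith
  refine (differentiable_riemannZeta₁.differentiableOn.analyticOnNhd hUo).eqOn_of_preconnected_of_eventuallyEq
    (hd.analyticOnNhd hUo) hUc (z₀ := 2) ⟨by simp; norm_num, ?_⟩ ?_ ⟨?_, ?_⟩
  · simp [R]; linarith [norm_nonneg s]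
  · have : {z : ℂ | 1 < z.re} ∈ nhds (2 : ℂ) :=
      (isOpen_lt continuous_const Complex.continuous_re).mem_nhds (by simp)
    filter_upwards [this] with z hz
    exact riemannZeta₁_eq_of_one_lt_re hz
  · simp only [mem_ofPred_eq]; linarith
  · simp [R]

lemma le_exp_mul_div {ε : ℝ} (hε : 0 < ε) (x : ℝ) : x ≤ Real.exp (ε * x) / ε := by
  rw [le_div_iff₀ hε]
  linarith [Real.add_one_le_exp (ε * x)]

/-- Dividing by `|s-1| ≥ 1` gives `|ζ(s)| ≤ 1 + K|s|`, and linear growth is absorbed by any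
exponential. -/
lemma stripBound_riemannZeta_of_half_le (B : ℝ) {ε : ℝ} (hε : 0 < ε) :
    StripBound riemannZeta (1 / 2) B ε := by
  set K : ℝ := ∑' n : ℕ, (n + 1 : ℝ) ^ (-(3 / 2) : ℝ) with hK
  have hsum := summable_succ_rpow_neg (x := 3 / 2) (by norm_num)
  have hK0 : 0 ≤ K := tsum_nonneg fun n => by positivity
  refine ⟨1 + (|B| + 1 / ε) * K, by positivity, fun s h1 h2 h3 => ?_⟩
  have hs1 : s ≠ 1 := by rintro rfl; norm_num at h3
  have hn : 1 ≤ ‖s - 1‖ := by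
    have := Complex.abs_im_le_norm (s - 1)
    simp only [sub_im, one_im, sub_zero] at this
    exact h3.trans this
  have hb : ‖∑' n, zetaCorrection n s‖ ≤ ‖s - 1‖ * ‖s‖ * K := by
    rw [hK, ← tsum_mul_left]
    refine tsum_of_norm_bounded (hsum.mul_left _).hasSum fun n => ?_
    refine (norm_zetaCorrection_le n (by linarith)).trans ?_
    gcongr
    · have : (0 : ℝ) ≤ n := Nat.cast_nonneg n
      linarith
    · linarith
  have hz : ‖riemannZeta s‖ ≤ 1 + ‖s‖ * K := by
    rw [riemannZeta_eq_inv_sub_mul hs1, riemannZeta₁_eq_of_half_le_re h1, norm_mul, norm_inv,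
      inv_mul_le_iff₀ (by linarith)]
    refine (norm_add_le _ _).trans ?_
    rw [norm_one]
    nlinarith
  have he : 1 ≤ Real.exp (ε * |s.im|) := Real.one_le_exp (by positivity)
  have hs : ‖s‖ ≤ (|B| + 1 / ε) * Real.exp (ε * |s.im|) := by
    refine (Complex.norm_le_abs_re_add_abs_im s).trans ?_
    have h4 : |s.re| ≤ |B| := by
      rw [abs_of_nonneg (by linarith : 0 ≤ s.re)]; exact h2.trans (le_abs_self _)
    have h5 := le_exp_mul_div hε |s.im|
    calc |s.re| + |s.im| ≤ |B| * Real.exp (ε * |s.im|) + Real.exp (ε * |s.im|) / ε := by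
          refine add_le_add (h4.trans ?_) h5
          exact le_mul_of_one_le_right (abs_nonneg _) he
      _ = _ := by ring
  calc _ ≤ 1 * Real.exp (ε * |s.im|) + (|B| + 1 / ε) * Real.exp (ε * |s.im|) * K := by
        refine hz.trans (add_le_add (by linarith) ?_)
        gcongr
    _ = _ := by ring

/-- Subexponential growth of `ζ` on vertical strips. -/
lemma stripBound_riemannZeta (A B : ℝ) {ε : ℝ} (hε : 0 < ε) :
    StripBound riemannZeta A B ε := by
  obtain ⟨δ, hδ, hδε, hδπ⟩ : ∃ δ : ℝ, 0 < δ ∧ 2 * δ ≤ ε ∧ δ ≤ Real.pi / 2 :=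
    ⟨min (ε / 2) (Real.pi / 2), by positivity, by linarith [min_le_left (ε / 2) (Real.pi / 2)],
      min_le_right _ _⟩
  -- The left part follows from the functional equation: `cos` grows at rate `π/2`, `Γ` decays at
  -- rate `π/2 - δ`, and `ζ` on the right costs another `δ`, for a total of `2δ ≤ ε`.
  have hleft : StripBound (fun s => riemannZeta (((-1 : ℝ) : ℂ) * s + (1 : ℝ))) (1 / 2) (1 - A) ε := by
    have h2pi : (2 * Real.pi : ℂ) ≠ 0 := by
      exact_mod_cast (by positivity : (2 * Real.pi : ℝ) ≠ 0)
    have ha : (2 * Real.pi : ℂ).arg = 0 := by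
      have : (2 * Real.pi : ℂ) = ((2 * Real.pi : ℝ) : ℂ) := by push_cast; rfl
      rw [this, arg_ofReal_of_nonneg (by positivity)]
    have hp := (stripBound_cpow h2pi (1 / 2) (1 - A) (-1)).const_mul 2
    have hG := stripBound_Gamma (1 / 2) (1 - A) (β := Real.pi / 2 - δ) (by linarith) (by linarith)
    have hc := stripBound_cos (1 / 2) (1 - A) (Real.pi / 2)
    have hz := stripBound_riemannZeta_of_half_le (1 - A) hδ
    refine (((hp.mul hG).mul hc).mul hz).congr ?_ |>.mono le_rfl le_rfl ?_
    · intro s h1 h2 h3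
      have := riemannZeta_one_sub (s := s) (fun n h => by rw [h] at h3; norm_num at h3)
        (by rintro rfl; norm_num at h3)
      rw [show ((-1 : ℝ) : ℂ) * s + (1 : ℝ) = 1 - s by push_cast; ring, this]
      push_cast
      rw [neg_one_mul, show (Real.pi : ℂ) / 2 * s = Real.pi * s / 2 by ring]
    · rw [ha, abs_of_pos (by positivity : 0 < Real.pi / 2)]
      simp
      linarith
  obtain ⟨C, hC, h⟩ := stripBound_riemannZeta_of_half_le B hε
  obtain ⟨D, hD, h'⟩ := hleft
  refine ⟨max C D, hC.trans (le_max_left _ _), fun s h1 h2 h3 => ?_⟩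
  rcases le_total (1 / 2) s.re with hs | hs
  · refine (h s hs h2 h3).trans ?_
    gcongr
    exact le_max_left _ _
  · have := h' (1 - s) (by simp; linarith) (by simp; linarith) (by simpa using h3)
    beta_reduce at this
    rw [show ((-1 : ℝ) : ℂ) * (1 - s) + (1 : ℝ) = s by push_cast; ring] at this
    have e : |(1 - s).im| = |s.im| := by simp
    rw [e] at this
    refine this.trans ?_
    gcongr
    exact le_max_right _ _

/-! ### Integrals along vertical lines and contour shifts -/

lemma integrable_exp_neg_mul_abs {κ : ℝ} (hκ : 0 < κ) :
    Integrable (fun t : ℝ => Real.exp (-κ * |t|)) := by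
  refine Integrable.mono' (integrable_inv_one_add_sq.const_mul (1 + 2 / κ ^ 2))
    (by fun_prop) (Filter.Eventually.of_forall fun t => ?_)
  rw [Real.norm_of_nonneg (Real.exp_pos _).le, neg_mul, Real.exp_neg, ← div_eq_mul_inv,
    inv_eq_one_div, div_le_div_iff₀ (Real.exp_pos _) (by positivity), one_mul]
  have h1 := Real.quadratic_le_exp_of_nonneg (x := κ * |t|) (by positivity)
  have h2 : (1 : ℝ) + t ^ 2 ≤ (1 + 2 / κ ^ 2) * (1 + κ * |t| + (κ * |t|) ^ 2 / 2) := by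
    have e : (1 + 2 / κ ^ 2) * (1 + κ * |t| + (κ * |t|) ^ 2 / 2) =
      1 + t ^ 2 + (κ * |t| + κ ^ 2 * t ^ 2 / 2 + 2 / κ ^ 2 + 2 / κ * |t|) := by
      rw [mul_pow, sq_abs]; field_simp; ring
    rw [e]
    have : 0 ≤ κ * |t| + κ ^ 2 * t ^ 2 / 2 + 2 / κ ^ 2 + 2 / κ * |t| := by positivity
    linarith
  refine h2.trans ?_
  gcongr

lemma integrable_vertical {f : ℂ → ℂ} {σ κ : ℝ} (hκ : 0 < κ)
    (hc : Continuous fun t : ℝ => f ((σ : ℂ) + t * I)) (hb : StripBound f σ σ (-κ)) :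
    Integrable (fun t : ℝ => f ((σ : ℂ) + t * I)) := by
  obtain ⟨C, hC, h⟩ := hb
  have hc' : Continuous fun t : ℝ => f ((σ : ℂ) + t * I) * Real.exp (κ * |t|) :=
    hc.mul (by fun_prop)
  obtain ⟨D, hD⟩ := (isCompact_Icc (a := (-1 : ℝ)) (b := 1)).exists_bound_of_continuousOn
    hc'.continuousOn
  refine Integrable.mono' ((integrable_exp_neg_mul_abs hκ).const_mul (max C D))
    hc.aestronglyMeasurable (Filter.Eventually.of_forall fun t => ?_)
  rcases le_total 1 |t| with ht | ht
  · have := h (σ + t * I) (by simp) (by simp) (by simpa using ht)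
    simp only [add_im, ofReal_im, mul_im, ofReal_re, I_im, mul_one, I_re, mul_zero, add_zero,
      zero_add] at this
    refine this.trans ?_
    gcongr
    exact le_max_left _ _
  · have := hD t (abs_le.1 ht)
    rw [norm_mul, Complex.norm_real, Real.norm_of_nonneg (Real.exp_pos _).le] at this
    rw [neg_mul, Real.exp_neg, ← div_eq_mul_inv, le_div_iff₀ (Real.exp_pos _)]
    exact this.trans (le_max_right _ _)

lemma ofReal_add_mul_I_ne_zero {b : ℝ} (hb : b ≠ 0) (y : ℝ) : (b : ℂ) + y * I ≠ 0 := by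
  intro h
  have := congrArg Complex.re h
  simp at this
  exact hb this

/-- The antiderivative is `arctan(y/b) - (i/2) log(b² + y²)`. The logarithm is even and cancels on a
symmetric interval, so the symmetric limit exists although `1/(b+iy)` is not absolutely integrable.
-/
lemma integral_inv_vertical {b : ℝ} (hb : b ≠ 0) (T : ℝ) :
    ∫ y in (-T)..T, ((b : ℂ) + y * I)⁻¹ = ((2 * Real.arctan (T / b) : ℝ) : ℂ) := by
  have hder : ∀ y ∈ uIcc (-T) T, HasDerivAt (fun y : ℝ => ((Real.arctan (y / b) : ℝ) : ℂ)
      - I / 2 * ((Real.log (b ^ 2 + y ^ 2) : ℝ) : ℂ)) ((b : ℂ) + y * I)⁻¹ y := by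
    intro y _
    have hpos : 0 < b ^ 2 + y ^ 2 := by positivity
    have h1 := ((hasDerivAt_id y).div_const b).arctan.ofReal_comp
    have h2 := ((((hasDerivAt_id y).fun_pow 2).const_add (b ^ 2)).log hpos.ne').ofReal_comp.const_mul
      (I / 2)
    refine (h1.sub h2).congr_deriv ?_
    have h3 : (b : ℂ) ^ 2 + (y : ℂ) ^ 2 ≠ 0 := by exact_mod_cast hpos.ne'
    have h4 : (b : ℂ) ≠ 0 := by exact_mod_cast hb
    have h5 := ofReal_add_mul_I_ne_zero hb y
    apply eq_inv_of_mul_eq_one_left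
    simp only [id, Nat.cast_ofNat]
    push_cast
    have h6 : (1 : ℂ) + ((y : ℂ) / b) ^ 2 = ((b : ℂ) ^ 2 + (y : ℂ) ^ 2) / b ^ 2 := by
      field_simp
    rw [h6]
    field_simp
    ring_nf
    rw [I_sq]
    ring
  rw [intervalIntegral.integral_eq_sub_of_hasDerivAt hder ?_]
  · rw [neg_div, Real.arctan_neg, neg_sq]
    push_cast
    ring
  · refine Continuous.intervalIntegrable ?_ _ _
    exact Continuous.inv₀ (by fun_prop) (ofReal_add_mul_I_ne_zero hb)

lemma integral_inv_sq_vertical {b : ℝ} (hb : b ≠ 0) (T : ℝ) :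
    ∫ y in (-T)..T, (((b : ℂ) + y * I) ^ 2)⁻¹
      = I * ((b : ℂ) + T * I)⁻¹ - I * ((b : ℂ) + (-T : ℝ) * I)⁻¹ := by
  have hder : ∀ y ∈ uIcc (-T) T, HasDerivAt (fun y : ℝ => I * ((b : ℂ) + y * I)⁻¹)
      (((b : ℂ) + y * I) ^ 2)⁻¹ y := by
    intro y _
    have h5 := ofReal_add_mul_I_ne_zero hb y
    have h1 : HasDerivAt (fun y : ℝ => (b : ℂ) + y * I) I y := by
      simpa using ((hasDerivAt_id (y : ℂ)).comp_ofReal.mul_const I).const_add (b : ℂ)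
    refine ((h1.fun_inv h5).const_mul I).congr_deriv ?_
    rw [div_eq_mul_inv]
    linear_combination (-(((b : ℂ) + y * I) ^ 2)⁻¹) * I_sq
  rw [intervalIntegral.integral_eq_sub_of_hasDerivAt hder ?_]
  refine Continuous.intervalIntegrable ?_ _ _
  exact Continuous.inv₀ (by fun_prop) (fun y => pow_ne_zero 2 (ofReal_add_mul_I_ne_zero hb y))

open Filter Topology

lemma tendsto_inv_vertical (b : ℝ) :
    Tendsto (fun T : ℝ => ((b : ℂ) + T * I)⁻¹) atTop (𝓝 0) := by
  rw [tendsto_zero_iff_norm_tendsto_zero]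
  refine squeeze_zero' (Eventually.of_forall fun T => norm_nonneg _) ?_ tendsto_inv_atTop_zero
  filter_upwards [eventually_gt_atTop 0] with T hT
  rw [norm_inv]
  have := Complex.abs_im_le_norm ((b : ℂ) + T * I)
  simp only [add_im, ofReal_im, mul_im, ofReal_re, I_im, mul_one, I_re, mul_zero, add_zero,
    zero_add] at this
  rw [abs_of_pos hT] at this
  gcongr

lemma tendsto_integral_inv_sq_vertical {b : ℝ} (hb : b ≠ 0) :
    Tendsto (fun T : ℝ => ∫ y in (-T)..T, (((b : ℂ) + y * I) ^ 2)⁻¹) atTop (𝓝 0) := by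
  simp_rw [integral_inv_sq_vertical hb]
  have h1 := tendsto_inv_vertical b
  have h2 := (tendsto_inv_vertical (-b)).neg
  have := (h1.const_mul I).sub (h2.const_mul I)
  simp only [neg_zero, mul_zero, sub_zero] at this
  refine this.congr fun T => ?_
  congr 2
  rw [neg_inv]
  congr 1
  push_cast
  ring

lemma tendsto_integral_inv_vertical_of_pos {b : ℝ} (hb : 0 < b) :
    Tendsto (fun T : ℝ => ∫ y in (-T)..T, ((b : ℂ) + y * I)⁻¹) atTop (𝓝 (Real.pi : ℂ)) := by
  simp_rw [integral_inv_vertical hb.ne']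
  refine (continuous_ofReal.tendsto _).comp ?_
  have h : Tendsto (fun T : ℝ => Real.arctan (T / b)) atTop (𝓝 (Real.pi / 2)) :=
    (Real.tendsto_arctan_atTop.mono_right nhdsWithin_le_nhds).comp
      (tendsto_id.atTop_div_const hb)
  simpa [mul_div_cancel₀] using h.const_mul 2

lemma tendsto_integral_inv_vertical_of_neg {b : ℝ} (hb : b < 0) :
    Tendsto (fun T : ℝ => ∫ y in (-T)..T, ((b : ℂ) + y * I)⁻¹) atTop (𝓝 (-Real.pi : ℂ)) := by
  have h := (tendsto_integral_inv_vertical_of_pos (b := -b) (by linarith)).neg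
  refine h.congr fun T => ?_
  rw [integral_inv_vertical hb.ne, integral_inv_vertical (by linarith : -b ≠ 0), div_neg,
    Real.arctan_neg]
  push_cast
  ring

/-- The principal part with poles of order at most two at the real points `x ∈ S`. -/
def principalPart (S : Finset ℝ) (q r : ℝ → ℂ) (z : ℂ) : ℂ :=
  ∑ x ∈ S, (q x * ((z - x) ^ 2)⁻¹ + r x * (z - x)⁻¹)

lemma differentiableAt_principalPart {S : Finset ℝ} {q r : ℝ → ℂ} {z : ℂ} (h : ∀ x ∈ S, z ≠ x) :
    DifferentiableAt ℂ (principalPart S q r) z := by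
  unfold principalPart
  refine DifferentiableAt.fun_sum fun x hx => ?_
  have : z - x ≠ 0 := sub_ne_zero.2 (h x hx)
  fun_prop (disch := simpa using this)

lemma norm_principalPart_le {S : Finset ℝ} {q r : ℝ → ℂ} {z : ℂ} (h : 1 ≤ |z.im|) :
    ‖principalPart S q r z‖ ≤ (∑ x ∈ S, (‖q x‖ + ‖r x‖)) * |z.im|⁻¹ := by
  unfold principalPart
  rw [Finset.sum_mul]
  refine (norm_sum_le _ _).trans (Finset.sum_le_sum fun x _ => ?_)
  have h0 : |z.im| ≤ ‖z - x‖ := by simpa using Complex.abs_im_le_norm (z - x)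
  have h1 : ‖(z - x)⁻¹‖ ≤ |z.im|⁻¹ := by
    rw [norm_inv]; gcongr
  have h2 : ‖((z - x) ^ 2)⁻¹‖ ≤ |z.im|⁻¹ := by
    rw [norm_inv, norm_pow]
    gcongr
    nlinarith
  refine (norm_add_le _ _).trans ?_
  rw [norm_mul, norm_mul, add_mul]
  gcongr

/-- Double poles contribute nothing in the limit, and each simple pole contributes the same `ε`,
namely `π` or `-π` according to the side of the line on which the points of `S` lie. -/
lemma tendsto_integral_principalPart {S : Finset ℝ} (q r : ℝ → ℂ) {σ : ℝ} (ε : ℂ)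
    (hne : ∀ x ∈ S, σ - x ≠ 0)
    (h : ∀ x ∈ S, Tendsto (fun T : ℝ => ∫ y in (-T)..T, (((σ - x : ℝ) : ℂ) + y * I)⁻¹)
      atTop (𝓝 ε)) :
    Tendsto (fun T : ℝ => ∫ y in (-T)..T, principalPart S q r ((σ : ℂ) + y * I)) atTop
      (𝓝 (ε * ∑ x ∈ S, r x)) := by
  have hc1 : ∀ x ∈ S, Continuous fun y : ℝ => (((σ - x : ℝ) : ℂ) + y * I)⁻¹ := fun x hx =>
    Continuous.inv₀ (by fun_prop) (ofReal_add_mul_I_ne_zero (hne x hx))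
  have hc2 : ∀ x ∈ S, Continuous fun y : ℝ => ((((σ - x : ℝ) : ℂ) + y * I) ^ 2)⁻¹ := fun x hx =>
    Continuous.inv₀ (by fun_prop) fun y => pow_ne_zero 2 (ofReal_add_mul_I_ne_zero (hne x hx) y)
  have e : ∀ T : ℝ, ∫ y in (-T)..T, principalPart S q r ((σ : ℂ) + y * I)
      = ∑ x ∈ S, (q x * (∫ y in (-T)..T, ((((σ - x : ℝ) : ℂ) + y * I) ^ 2)⁻¹)
        + r x * ∫ y in (-T)..T, (((σ - x : ℝ) : ℂ) + y * I)⁻¹) := by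
    intro T
    have e1 : ∀ y : ℝ, principalPart S q r ((σ : ℂ) + y * I) = ∑ x ∈ S,
        (q x * ((((σ - x : ℝ) : ℂ) + y * I) ^ 2)⁻¹ + r x * (((σ - x : ℝ) : ℂ) + y * I)⁻¹) := by
      intro y
      refine Finset.sum_congr rfl fun x _ => ?_
      rw [show (σ : ℂ) + y * I - x = ((σ - x : ℝ) : ℂ) + y * I by push_cast; ring]
    simp_rw [e1]
    rw [intervalIntegral.integral_finsetSum]
    · refine Finset.sum_congr rfl fun x hx => ?_
      rw [intervalIntegral.integral_add, intervalIntegral.integral_const_mul,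
        intervalIntegral.integral_const_mul]
      · exact ((hc2 x hx).const_mul _).intervalIntegrable _ _
      · exact ((hc1 x hx).const_mul _).intervalIntegrable _ _
    · intro x hx
      exact (((hc2 x hx).const_mul _).add ((hc1 x hx).const_mul _)).intervalIntegrable _ _
  simp_rw [e]
  rw [Finset.mul_sum]
  refine tendsto_finsetSum _ fun x hx => ?_
  have := ((tendsto_integral_inv_sq_vertical (hne x hx)).const_mul (q x)).add
    ((h x hx).const_mul (r x))
  simpa [mul_comm] using this

open Asymptotics in
lemma isLittleO_inv_sub_of_isBigO_one {h : ℂ → ℂ} {c : ℂ}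
    (hh : h =O[𝓝[≠] c] fun _ => (1 : ℂ)) : h =o[𝓝[≠] c] fun z => (z - c)⁻¹ := by
  refine hh.trans_isLittleO ?_
  rw [isLittleO_const_left]
  right
  have h1 : Tendsto (fun z : ℂ => z - c) (𝓝[≠] c) (𝓝[≠] 0) := by
    refine tendsto_nhdsWithin_iff.2 ⟨?_, ?_⟩
    · exact ((continuous_id.sub continuous_const).tendsto' c 0 (by simp)).mono_left
        nhdsWithin_le_nhds
    · filter_upwards [self_mem_nhdsWithin] with z hz
      exact sub_ne_zero.2 hz
  exact (tendsto_norm_inv_nhdsNE_zero_atTop (α := ℂ)).comp h1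

open Asymptotics in
/-- **Shift of a vertical contour** across finitely many real poles of order at most two, for a
function that decays exponentially on the strip. -/
theorem integral_vertical_sub_integral_vertical {f : ℂ → ℂ} {A B κ : ℝ} (hAB : A < B)
    (S : Finset ℝ) (q r : ℝ → ℂ) (hS : ∀ x ∈ S, A < x ∧ x < B)
    (hd : ∀ z : ℂ, A ≤ z.re → z.re ≤ B → (∀ x ∈ S, z ≠ x) → DifferentiableAt ℂ f z)
    (hpole : ∀ x ∈ S, (fun z => f z - (q x * ((z - x) ^ 2)⁻¹ + r x * (z - x)⁻¹))
      =o[𝓝[≠] (x : ℂ)] fun z => (z - x)⁻¹)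
    (hκ : 0 < κ) (hb : StripBound f A B (-κ)) :
    Integrable (fun t : ℝ => f ((A : ℂ) + t * I)) ∧ Integrable (fun t : ℝ => f ((B : ℂ) + t * I)) ∧
    (∫ t : ℝ, f ((B : ℂ) + t * I)) - ∫ t : ℝ, f ((A : ℂ) + t * I)
      = 2 * Real.pi * ∑ x ∈ S, r x := by
  have hne : ∀ σ : ℝ, (∀ x ∈ S, σ ≠ x) → ∀ t : ℝ, ∀ x ∈ S, (σ : ℂ) + t * I ≠ x := by
    intro σ h t x hx he
    have := congrArg Complex.re he
    simp at this
    exact h x hx this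
  have hneA := hne A fun x hx => (hS x hx).1.ne
  have hneB := hne B fun x hx => (hS x hx).2.ne'
  have hcont : ∀ σ : ℝ, A ≤ σ → σ ≤ B → (∀ x ∈ S, σ ≠ x) →
      Continuous fun t : ℝ => f ((σ : ℂ) + t * I) := by
    intro σ h1 h2 h3
    refine continuous_iff_continuousAt.2 fun t => ?_
    refine ContinuousAt.comp (f := fun t : ℝ => (σ : ℂ) + t * I) (g := f) ?_ (by fun_prop)
    exact (hd _ (by simpa using h1) (by simpa using h2) (hne σ h3 t)).continuousAt
  have hcA := hcont A le_rfl hAB.le fun x hx => (hS x hx).1.ne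
  have hcB := hcont B hAB.le le_rfl fun x hx => (hS x hx).2.ne'
  have hIA := integrable_vertical hκ hcA (hb.mono le_rfl hAB.le le_rfl)
  have hIB := integrable_vertical hκ hcB (hb.mono hAB.le le_rfl le_rfl)
  refine ⟨hIA, hIB, ?_⟩
  set P := principalPart S q r with hP
  set g : ℂ → ℂ := fun z => f z - P z with hg
  set S' : Set ℂ := (fun x : ℝ => (x : ℂ)) '' (S : Set ℝ) with hS'
  have hS'fin : S'.Finite := S.finite_toSet.image _
  have hmem : ∀ z, z ∉ S' ↔ ∀ x ∈ S, z ≠ x := by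
    intro z
    simp only [hS', mem_image, not_exists, not_and, Finset.mem_coe]
    exact ⟨fun h x hx e => h x hx e.symm, fun h x hx e => h x hx e.symm⟩
  classical
  -- After subtraction of the principal part the singularities are removable; `G` fills them in with
  -- the limits, so that Cauchy's theorem applies to a function continuous on the whole rectangle.
  set G : ℂ → ℂ := fun z => if z ∈ S' then limUnder (𝓝[≠] z) g else g z with hG
  have hgd : ∀ z : ℂ, A ≤ z.re → z.re ≤ B → z ∉ S' → DifferentiableAt ℂ g z := by
    intro z h1 h2 h3
    have h3 := (hmem z).1 h3
    exact (hd z h1 h2 h3).sub (differentiableAt_principalPart h3)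
  have hGoff : ∀ z ∉ S', G =ᶠ[𝓝 z] g := by
    intro z hz
    filter_upwards [hS'fin.isClosed.isOpen_compl.mem_nhds hz] with w hw
    simp only [hG, if_neg hw]
  have hGd : ∀ z : ℂ, A ≤ z.re → z.re ≤ B → z ∉ S' → DifferentiableAt ℂ G z :=
    fun z h1 h2 h3 => (hgd z h1 h2 h3).congr_of_eventuallyEq (hGoff z h3)
  have hGc : ∀ z : ℂ, A ≤ z.re → z.re ≤ B → ContinuousAt G z := by
    intro z h1 h2
    by_cases hz : z ∈ S'
    · obtain ⟨x, hx, rfl⟩ := hz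
      have hpunct : ∀ᶠ w in 𝓝[≠] (x : ℂ), w ∉ S' := by
        have hfin : (S' \ {(x : ℂ)}).Finite := hS'fin.sdiff
        have : (S' \ {(x : ℂ)})ᶜ ∈ 𝓝 (x : ℂ) := hfin.isClosed.isOpen_compl.mem_nhds (by simp)
        filter_upwards [nhdsWithin_le_nhds this, self_mem_nhdsWithin] with w hw hw'
        exact fun hw'' => hw ⟨hw'', hw'⟩
      have hstrip : ∀ᶠ w : ℂ in 𝓝[≠] (x : ℂ), A < w.re ∧ w.re < B := by
        refine nhdsWithin_le_nhds (Filter.Eventually.and ?_ ?_)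
        · exact (isOpen_lt continuous_const Complex.continuous_re).mem_nhds
            (by simpa using (hS x hx).1)
        · exact (isOpen_lt Complex.continuous_re continuous_const).mem_nhds
            (by simpa using (hS x hx).2)
      have hdiff : ∀ᶠ w in 𝓝[≠] (x : ℂ), DifferentiableAt ℂ g w := by
        filter_upwards [hpunct, hstrip] with w hw hw'
        exact hgd w hw'.1.le hw'.2.le hw
      -- Riemann's criterion needs `g - g x = o(1/(z-x))`. The principal parts at the other points
      -- and the constant `g x` are bounded near `x`, hence negligible.
      have hlim := tendsto_limUnder_of_differentiable_on_punctured_nhds_of_isLittleO hdiff (by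
        have hrest : DifferentiableAt ℂ (principalPart (S.erase x) q r) x :=
          differentiableAt_principalPart fun y hy he => by
            rw [Finset.mem_erase] at hy
            exact hy.1 (by exact_mod_cast he.symm)
        have h3 := (hpole x hx).sub (isLittleO_inv_sub_of_isBigO_one
          ((hrest.continuousAt.tendsto.mono_left nhdsWithin_le_nhds).isBigO_one (F := ℂ)))
        have h4 := h3.sub (isLittleO_inv_sub_of_isBigO_one
          (isBigO_const_const (g x) (one_ne_zero (α := ℂ)) (𝓝[≠] (x : ℂ))))
        refine h4.congr_left fun z => ?_
        have e : P z = (q x * ((z - x) ^ 2)⁻¹ + r x * (z - x)⁻¹)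
            + principalPart (S.erase x) q r z := (Finset.add_sum_erase S _ hx).symm
        simp only [hg, e]
        ring)
      rw [continuousAt_iff_punctured_nhds]
      have : G x = limUnder (𝓝[≠] (x : ℂ)) g := by
        simp only [hG]; rw [if_pos ⟨x, hx, rfl⟩]
      rw [this]
      refine hlim.congr' ?_
      filter_upwards [hpunct] with w hw
      simp only [hG, if_neg hw]
    · exact (hGd z h1 h2 hz).continuousAt
  have hGA : ∀ t : ℝ, G (A + t * I) = g (A + t * I) := fun t => by
    simp only [hG]; rw [if_neg ((hmem _).2 (hneA t))]
  have hGB : ∀ t : ℝ, G (B + t * I) = g (B + t * I) := fun t => by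
    simp only [hG]; rw [if_neg ((hmem _).2 (hneB t))]
  have hPc : ∀ σ : ℝ, (∀ x ∈ S, σ ≠ x) → Continuous fun t : ℝ => P ((σ : ℂ) + t * I) := by
    intro σ h3
    refine continuous_iff_continuousAt.2 fun t => ?_
    refine ContinuousAt.comp (f := fun t : ℝ => (σ : ℂ) + t * I) (g := P) ?_ (by fun_prop)
    exact (differentiableAt_principalPart (hne σ h3 t)).continuousAt
  have hPcA := hPc A fun x hx => (hS x hx).1.ne
  have hPcB := hPc B fun x hx => (hS x hx).2.ne'
  -- Cauchy's theorem on rectangles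
  have hrect : ∀ T : ℝ, 0 < T →
      (∫ x in A..B, g (x + (-T : ℝ) * I)) - (∫ x in A..B, g (x + (T : ℝ) * I)) +
      I * ((∫ y in (-T)..T, f ((B : ℂ) + y * I)) - ∫ y in (-T)..T, P ((B : ℂ) + y * I)) -
      I * ((∫ y in (-T)..T, f ((A : ℂ) + y * I)) - ∫ y in (-T)..T, P ((A : ℂ) + y * I)) = 0 := by
    intro T hT
    have hoff : ∀ u : ℝ, u ≠ 0 → ∀ x : ℝ, G (x + u * I) = g (x + u * I) := by
      intro u hu x
      have : (x : ℂ) + u * I ∉ S' := by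
        rw [hmem]
        intro y _ he
        have := congrArg Complex.im he
        simp at this
        exact hu this
      simp only [hG, if_neg this]
    have := integral_boundary_rect_eq_zero_of_differentiable_on_off_countable G ⟨A, -T⟩ ⟨B, T⟩ S'
      hS'fin.countable
      (fun z hz => by
        rw [mem_reProdIm, uIcc_of_le hAB.le] at hz
        exact (hGc z hz.1.1 hz.1.2).continuousWithinAt)
      (fun z hz => by
        have h1 := hz.1.1
        simp only [min_eq_left hAB.le, max_eq_right hAB.le] at h1
        exact hGd z h1.1.le h1.2.le hz.2)
    simp only [smul_eq_mul] at this
    simp_rw [hGA, hGB, hoff (-T) (by linarith), hoff T hT.ne'] at this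
    simp only [hg] at this ⊢
    rwa [intervalIntegral.integral_sub (hcB.intervalIntegrable _ _) (hPcB.intervalIntegrable _ _),
      intervalIntegral.integral_sub (hcA.intervalIntegrable _ _) (hPcA.intervalIntegrable _ _)]
      at this
  obtain ⟨C, hC, hCb⟩ := hb
  set D : ℝ := ∑ x ∈ S, (‖q x‖ + ‖r x‖)
  -- On the horizontal sides `f` is exponentially small and the principal part is `O(1/T)`; `u`
  -- stands for either of `T` and `-T`.
  have hhor : ∀ u : ℝ → ℝ, (∀ T, 0 ≤ T → |u T| = T) →
      Tendsto (fun T : ℝ => ∫ x in A..B, g (x + (u T : ℝ) * I)) atTop (𝓝 0) := by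
    intro u hu
    rw [tendsto_zero_iff_norm_tendsto_zero]
    have hz : Tendsto (fun T : ℝ => (C * Real.exp (-κ * T) + D * T⁻¹) * |B - A|) atTop (𝓝 0) := by
      have h1 : Tendsto (fun T : ℝ => Real.exp (-κ * T)) atTop (𝓝 0) :=
        Real.tendsto_exp_atBot.comp ((tendsto_const_mul_atBot_of_neg (by linarith)).2 tendsto_id)
      have := ((h1.const_mul C).add (tendsto_inv_atTop_zero.const_mul D)).mul_const |B - A|
      simpa using this
    refine squeeze_zero' (Eventually.of_forall fun T => norm_nonneg _) ?_ hz
    filter_upwards [eventually_ge_atTop 1] with T hT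
    have hT' := hu T (by linarith)
    refine intervalIntegral.norm_integral_le_of_norm_le_const fun x hx => ?_
    rw [uIoc_of_le hAB.le] at hx
    have him : ((x : ℂ) + (u T : ℝ) * I).im = u T := by simp
    refine (norm_sub_le _ _).trans (add_le_add ?_ ?_)
    · have := hCb ((x : ℂ) + (u T : ℝ) * I) (by simpa using hx.1.le) (by simpa using hx.2)
        (by rw [him, hT']; exact hT)
      rwa [him, hT'] at this
    · have := norm_principalPart_le (S := S) (q := q) (r := r) (z := (x : ℂ) + (u T : ℝ) * I)
        (by rw [him, hT']; exact hT)
      rwa [him, hT'] at this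
  have h1 := hhor (fun T => -T) fun T hT => by rw [abs_neg, abs_of_nonneg hT]
  have h2 := hhor (fun T => T) fun T hT => abs_of_nonneg hT
  have hfB := intervalIntegral_tendsto_integral hIB tendsto_neg_atTop_atBot tendsto_id
  have hfA := intervalIntegral_tendsto_integral hIA tendsto_neg_atTop_atBot tendsto_id
  -- All poles lie to the left of `Re z = B` and to the right of `Re z = A`, so the principal part
  -- contributes `π` and `-π` times the sum of the residues; the difference is the factor `2π`.
  have hPB := tendsto_integral_principalPart q r (σ := B) (S := S) Real.pi
    (fun x hx => by linarith [(hS x hx).2] |> fun h : 0 < B - x => h.ne')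
    (fun x hx => tendsto_integral_inv_vertical_of_pos (by linarith [(hS x hx).2]))
  have hPA := tendsto_integral_principalPart q r (σ := A) (S := S) (-Real.pi)
    (fun x hx => by linarith [(hS x hx).1] |> fun h : A - x < 0 => h.ne)
    (fun x hx => tendsto_integral_inv_vertical_of_neg (by linarith [(hS x hx).1]))
  have hlim := (((h1.sub h2).add ((hfB.sub hPB).const_mul I)).sub ((hfA.sub hPA).const_mul I))
  have hzero : Tendsto (fun _ : ℝ => (0 : ℂ)) atTop (𝓝 0) := tendsto_const_nhds
  have := tendsto_nhds_unique (hlim.congr' ?_) hzero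
  · have h3 : I * ((∫ t : ℝ, f ((B : ℂ) + t * I)) - (∫ t : ℝ, f ((A : ℂ) + t * I))
        - 2 * Real.pi * ∑ x ∈ S, r x) = 0 := by
      rw [← this]; ring
    rcases mul_eq_zero.1 h3 with h3 | h3
    · exact absurd h3 I_ne_zero
    · linear_combination h3
  · filter_upwards [eventually_gt_atTop 0] with T hT
    exact hrect T hT


/-! ### The Mellin–Barnes representation of the Bessel function -/

/-- A positive real factor leaves the argument unchanged, so principal powers multiply with no
branch correction. -/
lemma ofReal_mul_cpow {r : ℝ} (hr : 0 < r) {x : ℂ} (hx : x ≠ 0) (w : ℂ) :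
    ((r : ℂ) * x) ^ w = (r : ℂ) ^ w * x ^ w := by
  have hr' : (r : ℂ) ≠ 0 := by exact_mod_cast hr.ne'
  rw [cpow_def_of_ne_zero (mul_ne_zero hr' hx), cpow_def_of_ne_zero hr', cpow_def_of_ne_zero hx,
    log_ofReal_mul hr hx, ← Complex.exp_add, ofReal_log hr.le]
  congr 1
  ring

lemma continuous_vertical_of_differentiableAt {f : ℂ → ℂ} {σ : ℝ}
    (h : ∀ z : ℂ, z.re = σ → DifferentiableAt ℂ f z) :
    Continuous fun t : ℝ => f ((σ : ℂ) + t * I) := by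
  refine continuous_iff_continuousAt.2 fun t => ?_
  refine ContinuousAt.comp (f := fun t : ℝ => (σ : ℂ) + t * I) (g := f) ?_ (by fun_prop)
  exact (h _ (by simp)).continuousAt

lemma differentiableAt_Gamma_of_re_pos {s : ℂ} (hs : 0 < s.re) :
    DifferentiableAt ℂ Complex.Gamma s := by
  refine Complex.differentiableAt_Gamma s fun m h => ?_
  rw [h] at hs
  simp at hs
  linarith [(Nat.cast_nonneg m : (0 : ℝ) ≤ m)]

lemma integrable_Gamma_mul_cpow {σ : ℝ} (hσ : 0 < σ) {y : ℂ} (hy : 0 < y.re) :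
    Integrable fun t : ℝ => Complex.Gamma ((σ : ℂ) + t * I) * y ^ (-((σ : ℂ) + t * I)) := by
  have hy0 : y ≠ 0 := by rintro rfl; simp at hy
  have harg : |y.arg| < Real.pi / 2 := Complex.abs_arg_lt_pi_div_two_iff.2 (Or.inl hy)
  -- The rate is the midpoint of `|arg y|` and `π/2`, so that `Γ` beats the growth of the power.
  have hG := stripBound_Gamma σ σ (β := (Real.pi / 2 + |y.arg|) / 2) (by positivity) (by linarith)
  have hc := stripBound_cpow hy0 σ σ (-1)
  refine integrable_vertical (f := fun s => Complex.Gamma s * y ^ (-s))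
    (κ := (Real.pi / 2 - |y.arg|) / 2) (by linarith) ?_ ?_
  · refine continuous_vertical_of_differentiableAt (f := fun s => Complex.Gamma s * y ^ (-s))
      fun z hz => ?_
    refine (differentiableAt_Gamma_of_re_pos (by rw [hz]; exact hσ)).mul ?_
    exact DifferentiableAt.const_cpow (by fun_prop) (Or.inl hy0)
  · refine ((hG.mul hc).congr ?_).mono le_rfl le_rfl ?_
    · intro s _ _ _
      push_cast
      rw [neg_one_mul]
    · rw [abs_neg, abs_one]; linarith

/-- The Cahen–Mellin integral for the exponential. -/
lemma integral_Gamma_mul_cpow {σ : ℝ} (hσ : 0 < σ) {y : ℂ} (hy : 0 < y.re) :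
    ∫ t : ℝ, Complex.Gamma ((σ : ℂ) + t * I) * y ^ (-((σ : ℂ) + t * I))
      = 2 * Real.pi * Complex.exp (-y) := by
  set f : ℝ → ℂ := fun x => Complex.exp (-(y * x)) with hf
  have hmel : ∀ s : ℂ, 0 < s.re → mellin f s = Complex.Gamma s * y ^ (-s) := by
    intro s hs
    rw [mellin, mul_comm, ← integral_cpow_mul_exp_neg_complex_mul hs hy]
    rfl
  -- Mellin inversion of `x ↦ exp(-yx)`, evaluated at `x = 1`.
  have h := mellinInv_mellin_eq σ f one_pos
    (integrableOn_cpow_mul_exp_neg_mul (a := σ) (r := y) (by simpa using hσ) hy)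
    (by
      refine (integrable_Gamma_mul_cpow hσ hy).congr (Eventually.of_forall fun t => ?_)
      exact (hmel _ (by simpa using hσ)).symm)
    (by simp only [hf]; fun_prop)
  have hpi : (Real.pi : ℂ) ≠ 0 := by exact_mod_cast Real.pi_ne_zero
  have hm : ∀ t : ℝ, mellin f ((σ : ℂ) + t * I)
      = Complex.Gamma ((σ : ℂ) + t * I) * y ^ (-((σ : ℂ) + t * I)) :=
    fun t => hmel _ (by simpa using hσ)
  simp only [mellinInv, ofReal_one, one_cpow, one_smul, hm] at h
  have h1 : f 1 = Complex.exp (-y) := by simp [hf]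
  have h2 : (2 * Real.pi : ℂ) * ((1 / (2 * Real.pi) : ℝ) : ℂ) = 1 := by
    push_cast
    field_simp
  rw [← h1, ← h, Complex.real_smul, ← mul_assoc, h2, one_mul]

lemma integral_Ioi_eq_integral_exp (g : ℝ → ℂ) :
    ∫ v in Ioi (0 : ℝ), g v = ∫ t : ℝ, (Real.exp t : ℂ) * g (Real.exp t) := by
  have h := integral_image_eq_integral_abs_deriv_smul (s := univ) (f := Real.exp) (f' := Real.exp)
    MeasurableSet.univ (fun x _ => (Real.hasDerivAt_exp x).hasDerivWithinAt)
    Real.exp_injective.injOn g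
  rw [image_univ, Real.range_exp] at h
  rw [h, Measure.restrict_univ]
  simp [abs_of_pos, Real.exp_pos]

lemma integrableOn_Ioi_iff_integrable_exp (g : ℝ → ℂ) :
    IntegrableOn g (Ioi (0 : ℝ)) ↔ Integrable fun t : ℝ => (Real.exp t : ℂ) * g (Real.exp t) := by
  have h := integrableOn_image_iff_integrableOn_abs_deriv_smul (s := univ) (f := Real.exp)
    (f' := Real.exp)
    MeasurableSet.univ (fun x _ => (Real.hasDerivAt_exp x).hasDerivWithinAt)
    Real.exp_injective.injOn g
  rw [image_univ, Real.range_exp] at h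
  rw [h, integrableOn_univ]
  simp [abs_of_pos, Real.exp_pos]

/-- The integrand of the representation of `K_ν` over the positive half-line. -/
def besselKernel (ν : ℝ) (z : ℂ) (v : ℝ) : ℂ :=
  (v : ℂ) ^ (-(ν : ℂ) - 1) * Complex.exp (-(z / 2 * v)) * Complex.exp (-(z / 2 / v))

/-- The substitution `v = e^t` turns `(z/2)(v + 1/v)` into `z cosh t`. -/
lemma exp_mul_besselKernel_exp (ν : ℝ) (z : ℂ) (t : ℝ) :
    (Real.exp t : ℂ) * besselKernel ν z (Real.exp t)
      = Complex.exp (-z * (Real.cosh t : ℂ)) * Complex.exp (-(ν * t)) := by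
  rw [besselKernel, cpow_def_of_ne_zero (by exact_mod_cast (Real.exp_pos t).ne'),
    ← ofReal_log (Real.exp_pos t).le, Real.log_exp, ofReal_exp, div_eq_mul_inv (z / 2),
    ← Complex.exp_neg, ← Complex.exp_add, ← Complex.exp_add, ← Complex.exp_add, ← Complex.exp_add,
    ofReal_cosh, Complex.cosh]
  congr 1
  ring

/-- Folding the line at `t = 0` combines `e^(-νt)` and `e^(νt)` into `2 cosh(νt)`. -/
lemma integral_besselKernel {ν : ℝ} {z : ℂ} (hint : IntegrableOn (besselKernel ν z) (Ioi 0)) :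
    ∫ v in Ioi (0 : ℝ), besselKernel ν z v = 2 * besselK ν z := by
  rw [integrableOn_Ioi_iff_integrable_exp] at hint
  rw [integral_Ioi_eq_integral_exp]
  simp_rw [exp_mul_besselKernel_exp] at hint ⊢
  have hreflect := integral_comp_neg_Ioi 0
      (f := fun t : ℝ => Complex.exp (-z * (Real.cosh t : ℂ)) * Complex.exp (-(ν * t)))
  rw [neg_zero] at hreflect
  rw [← intervalIntegral.integral_Iic_add_Ioi (b := 0) hint.integrableOn hint.integrableOn,
    ← hreflect]
  · have hneg := hint.comp_neg
    rw [← integral_add hneg.integrableOn hint.integrableOn, besselK, ← integral_const_mul]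
    refine integral_congr_ae (Eventually.of_forall fun t => ?_)
    simp only [Real.cosh_neg]
    rw [ofReal_cosh (ν * t), Complex.cosh]
    push_cast
    ring_nf

/-- The Mellin–Barnes representation of `K_ν`. -/
lemma integral_Gamma_mul_Gamma_mul_cpow {ν σ : ℝ} (hσ : 0 < σ) (hνσ : ν < σ) {z : ℂ}
    (hz : 0 < z.re) :
    ∫ t : ℝ, Complex.Gamma ((σ : ℂ) + t * I) * Complex.Gamma ((σ : ℂ) + t * I - ν)
        * (z / 2) ^ (((-2 : ℝ) : ℂ) * ((σ : ℂ) + t * I))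
      = 4 * Real.pi * ((z / 2) ^ (-(ν : ℂ)) * besselK ν z) := by
  have hz2 : 0 < (z / 2).re := by simp; linarith
  have hz0 : z / 2 ≠ 0 := by intro h; rw [h] at hz2; simp at hz2
  -- Fubini for `F`: integration in `v` produces `Γ(s-ν)`, while integration in `t` is the
  -- Cahen–Mellin integral with `y = z/(2v)` and produces the Bessel kernel.
  set F : ℝ → ℝ → ℂ := fun t v => (Complex.Gamma ((σ : ℂ) + t * I) * (z / 2) ^ (-((σ : ℂ) + t * I)))
    * ((v : ℂ) ^ ((σ : ℂ) + t * I - ν - 1) * Complex.exp (-(z / 2 * v))) with hF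
  have hA := integrable_Gamma_mul_cpow hσ hz2
  have hint : Integrable (Function.uncurry F) (volume.prod (volume.restrict (Ioi 0))) := by
    refine Integrable.mono' (hA.norm.mul_prod
      (integrableOn_rpow_mul_exp_neg_mul (σ := σ - ν) (by linarith) hz2)) ?_ ?_
    · refine AEStronglyMeasurable.mul (hA.aestronglyMeasurable.comp_fst) ?_
      refine Measurable.aestronglyMeasurable ?_
      fun_prop
    · have hm : ∀ᵐ x ∂(volume.prod (volume.restrict (Ioi (0 : ℝ)))), x ∈ {x : ℝ × ℝ | 0 < x.2} :=
        Measure.quasiMeasurePreserving_snd.ae (ae_restrict_mem measurableSet_Ioi)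
      filter_upwards [hm] with x hx
      have hx : 0 < x.2 := hx
      simp only [Function.uncurry, hF]
      rw [norm_mul]
      refine le_of_eq ?_
      congr 1
      rw [norm_cpow_mul_exp_neg_mul hx]
      simp
  have hinner : ∀ v : ℝ, 0 < v → ∫ t, F t v = 2 * Real.pi * besselKernel ν z v := by
    intro v hv
    have hv0 : (v : ℂ) ≠ 0 := by exact_mod_cast hv.ne'
    have h := integral_Gamma_mul_cpow hσ (y := ((v⁻¹ : ℝ) : ℂ) * (z / 2))
      (by rw [re_ofReal_mul]; positivity)
    have e : ∀ t : ℝ, F t v = ((v : ℂ) ^ (-(ν : ℂ) - 1) * Complex.exp (-(z / 2 * v))) *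
        (Complex.Gamma ((σ : ℂ) + t * I)
          * (((v⁻¹ : ℝ) : ℂ) * (z / 2)) ^ (-((σ : ℂ) + t * I))) := by
      intro t
      rw [ofReal_mul_cpow (inv_pos.2 hv) hz0, ofReal_inv,
        inv_cpow _ _ (by rw [arg_ofReal_of_nonneg hv.le]; exact Real.pi_pos.ne),
        cpow_neg _ ((σ : ℂ) + t * I), inv_inv]
      simp only [hF]
      rw [show (σ : ℂ) + t * I - ν - 1 = ((σ : ℂ) + t * I) + (-(ν : ℂ) - 1) by ring,
        cpow_add _ _ hv0]
      ring
    simp_rw [e]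
    rw [integral_const_mul, h, besselKernel, ofReal_inv]
    rw [show (v : ℂ)⁻¹ * (z / 2) = z / 2 / v by rw [div_eq_mul_inv (z / 2)]; ring]
    ring
  have hpi : (Real.pi : ℂ) ≠ 0 := by exact_mod_cast Real.pi_ne_zero
  -- Integrability of the kernel is a by-product of Fubini, the kernel being a multiple of the inner
  -- integral.
  have hkint : IntegrableOn (besselKernel ν z) (Ioi 0) := by
    have h := (hint.integral_prod_right).const_mul ((2 * Real.pi : ℂ)⁻¹)
    refine h.congr ?_
    filter_upwards [ae_restrict_mem measurableSet_Ioi] with v hv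
    simp only [Function.uncurry]
    rw [hinner v hv]
    field_simp
  have hswap := integral_integral_swap hint
  have hright : ∫ v in Ioi (0 : ℝ), ∫ t, F t v = 4 * Real.pi * besselK ν z := by
    rw [setIntegral_congr_fun measurableSet_Ioi (fun v hv => hinner v hv), integral_const_mul,
      integral_besselKernel hkint]
    ring
  have hleft : ∀ t : ℝ, ∫ v in Ioi (0 : ℝ), F t v = (z / 2) ^ (ν : ℂ) *
      (Complex.Gamma ((σ : ℂ) + t * I) * Complex.Gamma ((σ : ℂ) + t * I - ν)
        * (z / 2) ^ (((-2 : ℝ) : ℂ) * ((σ : ℂ) + t * I))) := by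
    intro t
    simp only [hF]
    rw [integral_const_mul, integral_cpow_mul_exp_neg_complex_mul (by simp; linarith) hz2]
    have e : (z / 2) ^ (-((σ : ℂ) + t * I)) * (z / 2) ^ (-((σ : ℂ) + t * I - ν))
        = (z / 2) ^ (ν : ℂ) * (z / 2) ^ (((-2 : ℝ) : ℂ) * ((σ : ℂ) + t * I)) := by
      rw [← cpow_add _ _ hz0, ← cpow_add _ _ hz0]
      congr 1
      push_cast
      ring
    linear_combination (Complex.Gamma ((σ : ℂ) + t * I) * Complex.Gamma ((σ : ℂ) + t * I - ν)) * e
  rw [hright] at hswap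
  simp_rw [hleft] at hswap
  rw [integral_const_mul] at hswap
  have hc : (z / 2) ^ (ν : ℂ) ≠ 0 := by simp [cpow_eq_zero_iff, hz0]
  rw [cpow_neg]
  refine mul_left_cancel₀ hc (hswap.trans ?_)
  field_simp


/-! ### The remainder integrand: decay, poles and change of truncation -/

lemma componentBase_eq (p : ℕ) (a : ℂ) (k : ℕ) :
    a / (2 * (2 * Real.pi * k) ^ p) = (((2 * (2 * Real.pi * k) ^ p)⁻¹ : ℝ) : ℂ) * a := by
  push_cast
  rw [div_eq_mul_inv, mul_comm]

lemma componentBase_ne_zero (p : ℕ) {a : ℂ} (ha : a ≠ 0) {k : ℕ} (hk : 1 ≤ k) :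
    a / (2 * (2 * Real.pi * k) ^ p) ≠ 0 := by
  have hk0 : (0 : ℝ) < k := by exact_mod_cast hk
  rw [componentBase_eq]
  exact mul_ne_zero (by exact_mod_cast (by positivity : (2 * (2 * Real.pi * k) ^ p)⁻¹ ≠ 0)) ha

lemma arg_componentBase (p : ℕ) (a : ℂ) {k : ℕ} (hk : 1 ≤ k) :
    (a / (2 * (2 * Real.pi * k) ^ p)).arg = a.arg := by
  have hk0 : (0 : ℝ) < k := by exact_mod_cast hk
  rw [componentBase_eq, Complex.arg_real_mul _ (by positivity)]

/-- Reflection of a factor `1 / (Γ(1 + s) sin(πs))`. -/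
lemma inv_Gamma_mul_inv_sin {s : ℂ} (hs : Complex.Gamma (1 + s) ≠ 0) :
    (Complex.Gamma (1 + s))⁻¹ * (Complex.sin (Real.pi * s))⁻¹
      = -(Real.pi : ℂ)⁻¹ * Complex.Gamma (-s) := by
  -- Where the sine vanishes the formula persists: the hypothesis leaves only `s = 0, 1, 2, …`, and
  -- there both sides are `0` by the conventions for `1/0` and for `Γ` at its poles.
  have h := Complex.Gamma_mul_Gamma_one_sub (-s)
  rw [sub_neg_eq_add, mul_neg, Complex.sin_neg] at h
  have hpi : (Real.pi : ℂ) ≠ 0 := by exact_mod_cast Real.pi_ne_zero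
  rw [div_eq_mul_inv, inv_neg] at h
  have h2 : Complex.Gamma (-s) = Real.pi * -(Complex.sin (Real.pi * s))⁻¹
      * (Complex.Gamma (1 + s))⁻¹ := by
    rw [← h, mul_assoc, mul_inv_cancel₀ hs, mul_one]
  rw [h2]
  field_simp

/-- In this form every factor has a known exponential rate, and `Γ(-s) Γ(-s-ν)` is the Gamma product
of the Bessel integrand at `-s`. -/
lemma remainderIntegrand_eq {ν : ℝ} (hν : 0 ≤ ν) (p : ℕ) (a : ℂ) (k : ℕ) {s : ℂ}
    (hs : 0 < s.re) :
    remainderIntegrand ν p a k s = ((Real.pi : ℂ) ^ 2)⁻¹ * (Complex.Gamma (1 + 2 * p * s)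
      * Complex.sin (Real.pi * p * s) * Complex.Gamma (-s) * Complex.Gamma (-s - ν)
      * (a / (2 * (2 * Real.pi * k) ^ p)) ^ (2 * s)) := by
  have h1 := inv_Gamma_mul_inv_sin (s := s)
    (Complex.Gamma_ne_zero_of_re_pos (by simp; linarith))
  have h2 := inv_Gamma_mul_inv_sin (s := s + ν)
    (Complex.Gamma_ne_zero_of_re_pos (by simp; linarith))
  rw [← add_assoc, show -(s + (ν : ℂ)) = -s - ν by ring] at h2
  rw [remainderIntegrand, div_eq_mul_inv (Complex.Gamma _), div_eq_mul_inv (Complex.sin _),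
    mul_inv, mul_inv]
  have h3 := congrArg₂ (· * ·) h1 h2
  have h4 : -(Real.pi : ℂ)⁻¹ * Complex.Gamma (-s) * (-(Real.pi : ℂ)⁻¹ * Complex.Gamma (-s - ν))
    = ((Real.pi : ℂ) ^ 2)⁻¹ * Complex.Gamma (-s) * Complex.Gamma (-s - ν) := by
    rw [← inv_pow]; ring
  rw [h4] at h3
  linear_combination (Complex.Gamma (1 + 2 * p * s)
      * (a / (2 * (2 * Real.pi * k) ^ p)) ^ (2 * s) * Complex.sin (Real.pi * p * s)) * h3

/-- `β` is so close to `π/2` that `M` times the deficit uses at most half of the margin `π/2 - φ`.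
-/
lemma exists_rate {φ : ℝ} (hφ0 : 0 ≤ φ) (hφ : φ < Real.pi / 2) (M : ℝ) (hM : 1 ≤ M) :
    ∃ β : ℝ, 0 ≤ β ∧ β < Real.pi / 2 ∧ (Real.pi / 2 - β) * M ≤ (Real.pi / 2 - φ) / 2 ∧
      (Real.pi / 2 - β) ≤ (Real.pi / 2 - φ) / 2 := by
  have hpos : 0 < (Real.pi / 2 - φ) / (2 * M) := by
    apply div_pos <;> linarith
  have hle : (Real.pi / 2 - φ) / (2 * M) ≤ (Real.pi / 2 - φ) / 2 := by
    apply div_le_div_of_nonneg_left <;> linarith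
  refine ⟨Real.pi / 2 - (Real.pi / 2 - φ) / (2 * M), by linarith, by linarith, ?_, by linarith⟩
  rw [sub_sub_cancel]
  refine le_of_eq ?_
  field_simp

/-- The decay `πp` of `Γ(1+2ps)` balances the growth of `sin πps`. The other two Gamma factors decay
at total rate `π` against the growth `2|arg a|` of the power; the loss in the rates costs at most a
quarter of the difference. -/
lemma stripBound_remainderIntegrand {ν : ℝ} (hν : 0 ≤ ν) {p : ℕ} (hp : 1 ≤ p) {a : ℂ}
    (ha : a ≠ 0) (harg : |a.arg| < Real.pi / 2) {k : ℕ} (hk : 1 ≤ k) {A : ℝ} (hA : 0 < A) (B : ℝ) :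
    StripBound (remainderIntegrand ν p a k) A B (-(Real.pi / 2 - |a.arg|)) := by
  have hp' : (1 : ℝ) ≤ p := by exact_mod_cast hp
  obtain ⟨β, hβ0, hβ, hβM, -⟩ := exists_rate (abs_nonneg _) harg (2 * p + 2) (by linarith)
  have h1 := (stripBound_Gamma (2 * p * A + 1) (2 * p * B + 1) hβ0 hβ).comp_affine
    (A := A) (B := B) (m := 2 * p) (w := 1) (by rw [abs_of_nonneg (by positivity)]; linarith)
    (fun x h1 h2 => ⟨by gcongr, by gcongr⟩)
  have h2 := stripBound_sin A B (Real.pi * p)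
  have h3 := (stripBound_Gamma (-B) (-A) hβ0 hβ).comp_affine
    (A := A) (B := B) (m := -1) (w := 0) (by simp)
    (fun x h1 h2 => ⟨by linarith, by linarith⟩)
  have h4 := (stripBound_Gamma (-B - ν) (-A - ν) hβ0 hβ).comp_affine
    (A := A) (B := B) (m := -1) (w := -ν) (by simp)
    (fun x h1 h2 => ⟨by linarith, by linarith⟩)
  have h5 := stripBound_cpow (componentBase_ne_zero p ha hk) A B 2
  rw [arg_componentBase p a hk] at h5
  refine ((((((h1.mul h2).mul h3).mul h4).mul h5).const_mul (((Real.pi : ℂ) ^ 2)⁻¹)).congr ?_).mono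
    le_rfl le_rfl ?_
  · intro s hs _ _
    rw [remainderIntegrand_eq hν p a k (by linarith)]
    push_cast
    rw [neg_one_mul, add_zero, add_comm (1 : ℂ), sub_eq_add_neg (-s)]
  · rw [abs_of_nonneg (by positivity : (0 : ℝ) ≤ 2 * p),
      abs_of_nonneg (by positivity : (0 : ℝ) ≤ Real.pi * p), abs_of_pos (two_pos : (0 : ℝ) < 2),
      abs_neg, abs_one]
    nlinarith

/-- The entire function `sin(p θ) / sin θ` at `θ = π s`. -/
def sinQuotient (p : ℕ) (s : ℂ) : ℂ :=
  (Polynomial.Chebyshev.U ℂ ((p - 1 : ℕ) : ℤ)).eval (Complex.cos (Real.pi * s))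

lemma sinQuotient_mul_sin {p : ℕ} (hp : 1 ≤ p) (s : ℂ) :
    sinQuotient p s * Complex.sin (Real.pi * s) = Complex.sin (Real.pi * p * s) := by
  rw [sinQuotient, Polynomial.Chebyshev.U_complex_cos]
  congr 1
  rw [Int.cast_natCast, Nat.cast_sub hp]
  push_cast
  ring

lemma differentiable_sinQuotient (p : ℕ) : Differentiable ℂ (sinQuotient p) := by
  unfold sinQuotient
  have h : Differentiable ℂ fun s : ℂ => Complex.cos (Real.pi * s) := by fun_prop
  exact (Polynomial.Chebyshev.U ℂ ((p - 1 : ℕ) : ℤ)).differentiable.comp h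

lemma U_eval_neg_one_pow_mul (m n : ℕ) (x : ℂ) :
    (Polynomial.Chebyshev.U ℂ (m : ℤ)).eval ((-1) ^ n * x)
      = (-1) ^ (n * m) * (Polynomial.Chebyshev.U ℂ (m : ℤ)).eval x := by
  rcases Nat.even_or_odd n with hn | hn
  · rw [hn.neg_one_pow, (hn.mul_right m).neg_one_pow, one_mul, one_mul]
  · rw [hn.neg_one_pow, neg_one_mul, Polynomial.Chebyshev.U_eval_neg, pow_mul, hn.neg_one_pow]
    congr 1
    rcases Nat.even_or_odd m with hm | hm
    · rw [hm.neg_one_pow, Int.negOnePow_even _ (by exact_mod_cast hm)]; simp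
    · rw [hm.neg_one_pow, Int.negOnePow_odd _ (by exact_mod_cast hm)]; simp

lemma sin_pi_mul_ofReal_ne_zero {ν : ℝ} (hν0 : 0 < ν) (hν1 : ν < 1) :
    Complex.sin (Real.pi * ν) ≠ 0 := by
  have : 0 < Real.sin (Real.pi * ν) :=
    Real.sin_pos_of_pos_of_lt_pi (by positivity) (by nlinarith [Real.pi_pos])
  exact_mod_cast this.ne'

lemma sinRatio_eq_sinQuotient {ν : ℝ} (hν0 : 0 ≤ ν) (hν1 : ν < 1) {p : ℕ} (hp : 1 ≤ p) :
    sinRatio ν p = sinQuotient p ν := by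
  rw [sinRatio]
  split_ifs with h
  · subst h
    rw [sinQuotient]
    simp only [ofReal_zero, mul_zero, Complex.cos_zero, Polynomial.Chebyshev.U_eval_one]
    rw [Int.cast_natCast, Nat.cast_sub hp]
    push_cast
    ring
  · have hs := sin_pi_mul_ofReal_ne_zero (lt_of_le_of_ne hν0 (Ne.symm h)) hν1
    rw [← sinQuotient_mul_sin hp, mul_div_cancel_right₀ _ hs]

lemma cos_natCast_mul_pi_sub (n : ℕ) (x : ℂ) :
    Complex.cos (n * Real.pi - x) = (-1) ^ n * Complex.cos x := by
  rw [Complex.cos_antiperiodic.nat_mul_sub_eq, Complex.cos_neg]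

/-- The shift by `nπ` changes the sign of the cosine by `(-1)^n`, and `U_(p-1)` has the parity of
`p-1`. This is the origin of the sign `(-1)^(pn)` in the finite series. -/
lemma sinQuotient_natCast_sub {p : ℕ} (hp : 1 ≤ p) (n : ℕ) (x : ℂ) :
    (-1 : ℂ) ^ n * sinQuotient p (n - x) = (-1) ^ (p * n) * sinQuotient p x := by
  rw [sinQuotient, show (Real.pi : ℂ) * (n - x) = n * Real.pi - Real.pi * x by ring,
    cos_natCast_mul_pi_sub, U_eval_neg_one_pow_mul, ← mul_assoc, ← pow_add, sinQuotient]
  congr 2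
  obtain ⟨m, rfl⟩ := Nat.exists_eq_add_of_le hp
  simp
  ring

/-- The numerator of the remainder integrand after removal of its removable singularities. -/
def remainderNumerator (ν : ℝ) (p : ℕ) (a : ℂ) (k : ℕ) (s : ℂ) : ℂ :=
  Complex.Gamma (1 + 2 * p * s) / (Complex.Gamma (1 + s) * Complex.Gamma (1 + s + ν))
    * (a / (2 * (2 * Real.pi * k) ^ p)) ^ (2 * s) * sinQuotient p s

lemma remainderIntegrand_eq_div_sin (ν : ℝ) {p : ℕ} (hp : 1 ≤ p) (a : ℂ) (k : ℕ) {s : ℂ}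
    (hs : Complex.sin (Real.pi * s) ≠ 0) :
    remainderIntegrand ν p a k s
      = remainderNumerator ν p a k s / Complex.sin (Real.pi * (s + ν)) := by
  rw [remainderIntegrand, remainderNumerator, ← sinQuotient_mul_sin hp,
    mul_comm (sinQuotient p s), mul_div_mul_left _ _ hs]
  ring

lemma differentiableAt_remainderNumerator {ν : ℝ} (hν : 0 ≤ ν) (p : ℕ) {a : ℂ} (ha : a ≠ 0)
    {k : ℕ} (hk : 1 ≤ k) {s : ℂ} (hs : 0 < s.re) :
    DifferentiableAt ℂ (remainderNumerator ν p a k) s := by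
  unfold remainderNumerator
  have h1 : 0 < (1 + 2 * p * s).re := by
    have : (1 + 2 * p * s).re = 1 + 2 * p * s.re := by simp
    rw [this]; positivity
  have h2 : 0 < (1 + s).re := by simp; linarith
  have h3 : 0 < (1 + s + ν).re := by simp; linarith
  refine DifferentiableAt.mul (DifferentiableAt.mul (DifferentiableAt.div ?_ ?_ ?_) ?_)
    (differentiable_sinQuotient p s)
  · exact (differentiableAt_Gamma_of_re_pos h1).fun_comp' s (by fun_prop)
  · exact ((differentiableAt_Gamma_of_re_pos h2).fun_comp' s (by fun_prop)).mul
      ((differentiableAt_Gamma_of_re_pos h3).fun_comp' s (by fun_prop))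
  · exact mul_ne_zero (Complex.Gamma_ne_zero_of_re_pos h2) (Complex.Gamma_ne_zero_of_re_pos h3)
  · exact DifferentiableAt.const_cpow (by fun_prop) (Or.inl (componentBase_ne_zero p ha hk))

open Asymptotics in
lemma isLittleO_of_tendsto_sub_mul {f : ℂ → ℂ} {c r : ℂ}
    (h : Tendsto (fun z => (z - c) * f z) (𝓝[≠] c) (𝓝 r)) :
    (fun z => f z - (0 * ((z - c) ^ 2)⁻¹ + r * (z - c)⁻¹)) =o[𝓝[≠] c] fun z => (z - c)⁻¹ := by
  refine (isLittleO_iff_tendsto' ?_).2 ?_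
  · filter_upwards [self_mem_nhdsWithin] with z hz h0
    exact absurd h0 (inv_ne_zero (sub_ne_zero.2 hz))
  · have := h.sub_const r
    rw [sub_self] at this
    refine this.congr' ?_
    filter_upwards [self_mem_nhdsWithin] with z hz
    have := sub_ne_zero.2 hz
    field_simp
    ring

/-- The residue of `H/g` at a simple zero of `g` is `H/g'`. -/
lemma tendsto_sub_mul_div_of_hasDerivAt {H g : ℂ → ℂ} {c g' : ℂ} (hH : ContinuousAt H c)
    (hg : HasDerivAt g g' c) (hg0 : g c = 0) (hg' : g' ≠ 0) :
    Tendsto (fun z => (z - c) * (H z / g z)) (𝓝[≠] c) (𝓝 (H c / g')) := by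
  have h1 := hasDerivAt_iff_tendsto_slope.1 hg
  have h2 := (hH.tendsto.mono_left nhdsWithin_le_nhds).div h1 hg'
  refine h2.congr' ?_
  filter_upwards [self_mem_nhdsWithin] with z hz
  have := sub_ne_zero.2 hz
  simp only [Pi.div_apply, slope_def_field, hg0, sub_zero]
  rw [div_div_eq_mul_div]
  ring

lemma hasDerivAt_sin_pi_add (ν x : ℂ) :
    HasDerivAt (fun s : ℂ => Complex.sin (Real.pi * (s + ν)))
      (Complex.cos (Real.pi * (x + ν)) * Real.pi) x := by
  have := (((hasDerivAt_id x).add_const ν).const_mul (Real.pi : ℂ)).csin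
  simpa using this

/-- The contour of the remainder integral can be moved to the right up to `N - 1 - ν < B < N - ν`,
crossing the poles `n - ν` for `1 ≤ n < N`. -/
lemma integral_remainderIntegrand_sub {ν : ℝ} (hν0 : 0 ≤ ν) {p : ℕ} (hp : 1 ≤ p)
    {a : ℂ} (ha : a ≠ 0) (harg : |a.arg| < Real.pi / 2) {k : ℕ} (hk : 1 ≤ k) {N : ℕ} {A B : ℝ}
    (hA0 : 0 < A) (hA1 : A < 1 - ν) (hAB : A < B) (hB0 : (N : ℝ) - 1 - ν < B) (hB1 : B < N - ν) :
    Integrable (fun t : ℝ => remainderIntegrand ν p a k ((A : ℂ) + t * I)) ∧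
    Integrable (fun t : ℝ => remainderIntegrand ν p a k ((B : ℂ) + t * I)) ∧
    (∫ t : ℝ, remainderIntegrand ν p a k ((B : ℂ) + t * I))
      - ∫ t : ℝ, remainderIntegrand ν p a k ((A : ℂ) + t * I)
      = 2 * Real.pi * ∑ n ∈ Finset.Ico 1 N, remainderNumerator ν p a k (n - ν)
          / ((-1) ^ n * Real.pi) := by
  have hpi : (Real.pi : ℂ) ≠ 0 := by exact_mod_cast Real.pi_ne_zero
  -- At integers the integrand takes the value `0` of a division by zero; `f` has these
  -- singularities removed. The two agree off the real axis, which a vertical line meets in a null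
  -- set, so the integrals coincide.
  set f : ℂ → ℂ := fun s => remainderNumerator ν p a k s / Complex.sin (Real.pi * (s + ν)) with hf
  have hsin : ∀ s : ℂ, s.im ≠ 0 → Complex.sin (Real.pi * s) ≠ 0 := by
    intro s hs h
    obtain ⟨m, hm⟩ := Complex.sin_eq_zero_iff.1 h
    have : s = m := mul_left_cancel₀ hpi (by rw [hm]; ring)
    rw [this] at hs
    simp at hs
  have hfeq : ∀ s : ℂ, s.im ≠ 0 → remainderIntegrand ν p a k s = f s :=
    fun s hs => remainderIntegrand_eq_div_sin ν hp a k (hsin s hs)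
  have hae : ∀ σ : ℝ, (fun t : ℝ => remainderIntegrand ν p a k ((σ : ℂ) + t * I))
      =ᵐ[volume] fun t : ℝ => f ((σ : ℂ) + t * I) := by
    intro σ
    filter_upwards [Measure.ae_ne volume (0 : ℝ)] with t ht
    exact hfeq _ (by simpa using ht)
  rw [integrable_congr (hae A), integrable_congr (hae B), integral_congr_ae (hae A),
    integral_congr_ae (hae B)]
  set S : Finset ℝ := (Finset.Ico 1 N).image (fun n : ℕ => (n : ℝ) - ν) with hS
  set r : ℝ → ℂ := fun x => remainderNumerator ν p a k x
    / (Complex.cos (Real.pi * (x + ν)) * Real.pi) with hr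
  have hcos : ∀ n : ℕ, Complex.cos (Real.pi * ((((n : ℝ) - ν : ℝ) : ℂ) + ν)) = (-1) ^ n := by
    intro n
    have := cos_natCast_mul_pi_sub n 0
    rw [sub_zero, Complex.cos_zero, mul_one] at this
    rw [← this]
    congr 1
    push_cast
    ring
  have hmain := integral_vertical_sub_integral_vertical (f := f) hAB S 0 r ?_ ?_ ?_
    (sub_pos.2 harg) ((stripBound_remainderIntegrand hν0 hp ha harg hk hA0 B).congr ?_)
  · refine ⟨hmain.1, hmain.2.1, ?_⟩
    rw [hmain.2.2, hS, Finset.sum_image (fun m _ n _ h => by simpa using h)]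
    congr 1
    refine Finset.sum_congr rfl fun n _ => ?_
    simp only [hr]
    rw [hcos]
    push_cast
    rfl
  · intro x hx
    obtain ⟨n, hn, rfl⟩ := Finset.mem_image.1 hx
    rw [Finset.mem_Ico] at hn
    have h1 : (1 : ℝ) ≤ n := by exact_mod_cast hn.1
    have h2 : (n : ℝ) + 1 ≤ N := by exact_mod_cast hn.2
    exact ⟨by linarith, by linarith⟩
  · intro z h1 h2 h3
    refine (differentiableAt_remainderNumerator hν0 p ha hk (by linarith)).div
      (hasDerivAt_sin_pi_add ν z).differentiableAt ?_
    intro h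
    obtain ⟨m, hm⟩ := Complex.sin_eq_zero_iff.1 h
    have hz : z + ν = m := mul_left_cancel₀ hpi (by rw [hm]; ring)
    have hre : z.re + ν = m := by simpa using congrArg Complex.re hz
    have hm0 : (0 : ℝ) < m := by rw [← hre]; linarith
    have hmN : (m : ℝ) < N := by rw [← hre]; linarith
    have hm0' : 0 < m := by exact_mod_cast hm0
    have hmN' : m < N := by exact_mod_cast hmN
    lift m to ℕ using hm0'.le
    refine h3 ((m : ℝ) - ν) (Finset.mem_image.2 ⟨m, Finset.mem_Ico.2 ⟨?_, ?_⟩, rfl⟩) ?_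
    · exact_mod_cast hm0'
    · exact_mod_cast hmN'
    · push_cast at hz ⊢
      rw [← hz]; ring
  · intro x hx
    obtain ⟨n, hn, rfl⟩ := Finset.mem_image.1 hx
    rw [Finset.mem_Ico] at hn
    have h1 : (1 : ℝ) ≤ n := by exact_mod_cast hn.1
    refine isLittleO_of_tendsto_sub_mul ?_
    refine tendsto_sub_mul_div_of_hasDerivAt
      (differentiableAt_remainderNumerator hν0 p ha hk ?_).continuousAt
      (hasDerivAt_sin_pi_add ν _) ?_ ?_
    · rw [ofReal_re]; linarith
    · refine Complex.sin_eq_zero_iff.2 ⟨n, ?_⟩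
      push_cast
      ring
    · rw [hcos]
      exact mul_ne_zero (pow_ne_zero _ (by norm_num)) hpi
  · intro s _ _ h3
    exact (hfeq s fun h => by rw [h] at h3; norm_num at h3).symm

/-- At `s = n-ν` the factor `Γ(1+s+ν)` becomes `n!`, and the residue is `1/π` times the `n`-th term
of the finite series. -/
lemma remainderNumerator_div {ν : ℝ} (hν0 : 0 ≤ ν) (hν1 : ν < 1) {p : ℕ} (hp : 1 ≤ p) (a : ℂ)
    (k n : ℕ) :
    remainderNumerator ν p a k (n - ν) / ((-1) ^ n * Real.pi)
      = (Real.pi : ℂ)⁻¹ * (sinRatio ν p * ((-1 : ℂ) ^ (p * n)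
      * (Complex.Gamma (1 + 2 * p * (n - ν)) / (n.factorial * Complex.Gamma (1 + (n - ν))))
      * (a / (2 * (2 * Real.pi * k) ^ p)) ^ (2 * n - 2 * ν : ℂ))) := by
  have h := sinQuotient_natCast_sub hp n (ν : ℂ)
  have hsq : ((-1 : ℂ) ^ n)⁻¹ = (-1) ^ n := by
    rw [← inv_pow]; norm_num
  have hfac : Complex.Gamma (1 + (n - ν) + ν) = n.factorial := by
    rw [← Complex.Gamma_nat_eq_factorial]; congr 1; ring
  rw [remainderNumerator, sinRatio_eq_sinQuotient hν0 hν1 hp, div_eq_mul_inv, mul_inv, hsq, hfac,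
    show (2 : ℂ) * (n - ν) = 2 * n - 2 * ν by ring, mul_comm (Complex.Gamma (1 + (n - ν : ℂ)))]
  linear_combination (Complex.Gamma (1 + 2 * p * (n - ν)) /
    (n.factorial * Complex.Gamma (1 + (n - ν)))
      * (a / (2 * (2 * Real.pi * k) ^ p)) ^ (2 * n - 2 * ν : ℂ) * (Real.pi : ℂ)⁻¹) * h

lemma integrable_remainderIntegrand {ν : ℝ} (hν0 : 0 ≤ ν) (hν1 : ν < 1) {p : ℕ} (hp : 1 ≤ p)
    {a : ℂ} (ha : a ≠ 0) (harg : |a.arg| < Real.pi / 2) {k : ℕ} (hk : 1 ≤ k) {N : ℕ} {B : ℝ}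
    (hB : 0 < B) (hB0 : (N : ℝ) - 1 - ν < B) (hB1 : B < N - ν) :
    Integrable (fun t : ℝ => remainderIntegrand ν p a k ((B : ℂ) + t * I)) := by
  have h1 : min B (1 - ν) / 2 < B := by
    have := min_le_left B (1 - ν)
    linarith
  have h2 : min B (1 - ν) / 2 < 1 - ν := by
    have := min_le_right B (1 - ν)
    linarith
  have h3 : 0 < min B (1 - ν) := lt_min hB (by linarith)
  exact (integral_remainderIntegrand_sub hν0 hp ha harg hk (A := min B (1 - ν) / 2) (by linarith)
    h2 h1 hB0 hB1).2.1

/-- Each component series plus its remainder does not depend on the truncation. -/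
lemma componentSeries_add_remainder {ν : ℝ} (hν0 : 0 ≤ ν) (hν1 : ν < 1) {p : ℕ} (hp : 1 ≤ p)
    {a : ℂ} (ha : a ≠ 0) (harg : |a.arg| < Real.pi / 2) {k : ℕ} (hk : 1 ≤ k) {N : ℕ} (hN : 1 ≤ N)
    {c : ℝ} (hc0 : 0 < c) (hc1 : c < 1) (hcN : N = 1 → c < 1 - ν) {A : ℝ} (hA0 : 0 < A)
    (hA1 : A < 1 - ν) :
    componentSeries ν p a k N + remainder ν p a k N c
      = -(1 / 4) * ∫ t : ℝ, remainderIntegrand ν p a k ((A : ℂ) + t * I) := by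
  have hpi : (Real.pi : ℂ) ≠ 0 := by exact_mod_cast Real.pi_ne_zero
  set B : ℝ := -c + N - ν with hB
  have hN' : (1 : ℝ) ≤ N := by exact_mod_cast hN
  have key : (∫ t : ℝ, remainderIntegrand ν p a k ((B : ℂ) + t * I))
      - ∫ t : ℝ, remainderIntegrand ν p a k ((A : ℂ) + t * I)
      = 2 * Real.pi * ∑ n ∈ Finset.Ico 1 N, remainderNumerator ν p a k (n - ν)
          / ((-1) ^ n * Real.pi) := by
    -- `B ≤ A` is possible only for `N = 1`. Then both lines lie in `0 < Re s < 1-ν`, by the extra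
    -- condition on `c`, and no pole separates them.
    rcases lt_trichotomy A B with h | h | h
    · exact (integral_remainderIntegrand_sub hν0 hp ha harg hk hA0 hA1 h
        (by linarith) (by linarith)).2.2
    all_goals
      have hN1 : N = 1 := by
        by_contra hne
        have : (2 : ℝ) ≤ N := by exact_mod_cast (by omega : 2 ≤ N)
        linarith
      subst hN1
      have := hcN rfl
      push_cast at hB
    · rw [← h]; simp
    · have h2 := (integral_remainderIntegrand_sub hν0 hp ha harg hk (N := 1) (A := B) (B := A)
        (by linarith) (by linarith) h (by push_cast; linarith) (by push_cast; linarith)).2.2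
      simp only [Finset.Ico_self, Finset.sum_empty, mul_zero] at h2 ⊢
      linear_combination -h2
  have hrem : remainder ν p a k N c
      = -(1 / 4) * ∫ t : ℝ, remainderIntegrand ν p a k ((B : ℂ) + t * I) := by
    rw [remainder]
    simp only [pathPoint]
    rw [integral_mul_const, ← hB]
    have h : -((Real.pi : ℂ) / (4 * Real.pi * I)) * I = -(1 / 4) := by field_simp
    linear_combination (∫ t : ℝ, remainderIntegrand ν p a k ((B : ℂ) + t * I)) * h
  have hser : componentSeries ν p a k N = Real.pi / 2 * ∑ n ∈ Finset.Ico 1 N,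
      remainderNumerator ν p a k (n - ν) / ((-1) ^ n * Real.pi) := by
    rw [componentSeries, Finset.mul_sum, Finset.mul_sum]
    refine Finset.sum_congr rfl fun n _ => ?_
    rw [remainderNumerator_div hν0 hν1 hp]
    field_simp
  rw [hrem, hser]
  linear_combination (-(1 / 4) : ℂ) * key


/-! ### The Bessel sum, the functional equation and the component integrals -/

lemma ofReal_pow_cpow {b : ℝ} (hb : 0 < b) (p : ℕ) (w : ℂ) :
    ((b ^ p : ℝ) : ℂ) ^ w = (b : ℂ) ^ (p * w) := by
  rw [cpow_def_of_ne_zero (by exact_mod_cast (pow_pos hb p).ne'),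
    cpow_def_of_ne_zero (by exact_mod_cast hb.ne'), ← ofReal_log (pow_pos hb p).le,
    ← ofReal_log hb.le, Real.log_pow]
  push_cast
  ring_nf

lemma ofReal_inv_pow_cpow {b : ℝ} (hb : 0 < b) (p : ℕ) (w : ℂ) :
    (((b ^ p)⁻¹ : ℝ) : ℂ) ^ w = (b : ℂ) ^ (-(p * w)) := by
  rw [ofReal_inv, inv_cpow _ _ (by
    rw [arg_ofReal_of_nonneg (pow_pos hb p).le]; exact Real.pi_pos.ne), ofReal_pow_cpow hb, cpow_neg]

/-- The Mellin transform of `(x/2)^(-ν) K_ν(x)`, times the power of the argument. -/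
def gammaPair (ν : ℝ) (x s : ℂ) : ℂ :=
  Complex.Gamma s * Complex.Gamma (s - ν) * x ^ (-2 * s)

/-- The Mellin–Barnes integrand for the Bessel sum. -/
def barnesMain (ν : ℝ) (p : ℕ) (x s : ℂ) : ℂ := gammaPair ν x s * riemannZeta (2 * p * s)

lemma stripBound_gammaPair (ν : ℝ) {x : ℂ} (hx : x ≠ 0) (harg : |x.arg| < Real.pi / 2) (A B : ℝ) :
    StripBound (gammaPair ν x) A B (-(3 / 2 * (Real.pi / 2 - |x.arg|))) := by
  obtain ⟨β, hβ0, hβ, hβM, -⟩ := exists_rate (abs_nonneg _) harg 2 (by norm_num)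
  have h1 := stripBound_Gamma A B hβ0 hβ
  have h2 := (stripBound_Gamma (A - ν) (B - ν) hβ0 hβ).comp_affine
    (A := A) (B := B) (m := 1) (w := -ν) (by simp)
    (fun x h1 h2 => ⟨by linarith, by linarith⟩)
  have h3 := stripBound_cpow hx A B (-2)
  refine (((h1.mul h2).mul h3).congr ?_).mono le_rfl le_rfl ?_
  · intro s _ _ _
    rw [gammaPair]
    push_cast
    rw [one_mul, sub_eq_add_neg]
  · rw [abs_one, abs_neg, abs_of_pos (two_pos : (0 : ℝ) < 2)]
    linarith

/-- The Gamma pair decays at `3/2` times the margin `π/2 - |arg x|`; half a margin is spent on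
`ζ(2ps)`. -/
lemma stripBound_barnesMain (ν : ℝ) {p : ℕ} (hp : 1 ≤ p) {x : ℂ} (hx : x ≠ 0)
    (harg : |x.arg| < Real.pi / 2) (A B : ℝ) :
    StripBound (barnesMain ν p x) A B (-(Real.pi / 2 - |x.arg|)) := by
  have hp' : (1 : ℝ) ≤ p := by exact_mod_cast hp
  have h2p : (0 : ℝ) < 2 * p := by linarith
  have hz := (stripBound_riemannZeta (2 * p * A) (2 * p * B)
    (ε := (Real.pi / 2 - |x.arg|) / 2 / (2 * p))
    (by apply div_pos _ h2p; linarith)).comp_affine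
    (A := A) (B := B) (m := 2 * p) (w := 0) (by rw [abs_of_pos h2p]; linarith)
    (fun x h1 h2 => ⟨by rw [add_zero]; gcongr, by rw [add_zero]; gcongr⟩)
  refine (((stripBound_gammaPair ν hx harg A B).mul hz).congr ?_).mono le_rfl le_rfl ?_
  · intro s _ _ _
    rw [barnesMain]
    push_cast
    rw [add_zero]
  · rw [abs_of_pos h2p, div_mul_cancel₀ _ h2p.ne']
    linarith

lemma differentiableAt_gammaPair {ν : ℝ} {x s : ℂ} (hx : x ≠ 0) (h1 : ∀ m : ℕ, s ≠ -m)
    (h2 : ∀ m : ℕ, s - ν ≠ -m) : DifferentiableAt ℂ (gammaPair ν x) s := by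
  unfold gammaPair
  refine ((Complex.differentiableAt_Gamma s h1).mul
    ((Complex.differentiableAt_Gamma _ h2).fun_comp' s (by fun_prop))).mul ?_
  exact DifferentiableAt.const_cpow (by fun_prop) (Or.inl hx)

lemma ne_neg_natCast_of_re_pos {s : ℂ} (hs : 0 < s.re) (m : ℕ) : s ≠ -m := by
  rintro rfl
  simp at hs
  linarith [(Nat.cast_nonneg m : (0 : ℝ) ≤ m)]

lemma integrable_gammaPair {ν σ : ℝ} (hσ : 0 < σ) (hνσ : ν < σ) {x : ℂ} (hx : x ≠ 0)
    (harg : |x.arg| < Real.pi / 2) :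
    Integrable fun t : ℝ => gammaPair ν x ((σ : ℂ) + t * I) := by
  refine integrable_vertical (by linarith) ?_ (stripBound_gammaPair ν hx harg σ σ)
  refine continuous_vertical_of_differentiableAt fun z hz => ?_
  exact differentiableAt_gammaPair hx (ne_neg_natCast_of_re_pos (by linarith))
    (ne_neg_natCast_of_re_pos (by simp; linarith))

lemma gammaPair_pow_mul {ν : ℝ} {p n : ℕ} {x s : ℂ} (hx : x ≠ 0) :
    gammaPair ν ((((n + 1 : ℝ) ^ p : ℝ) : ℂ) * x) s
      = gammaPair ν x s * ((n + 1 : ℝ) : ℂ) ^ (-(2 * p * s)) := by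
  rw [gammaPair, ofReal_mul_cpow (by positivity) hx, ofReal_pow_cpow (by positivity), gammaPair,
    show (p : ℂ) * (-2 * s) = -(2 * p * s) by ring]
  ring

/-- The Bessel sum as a Mellin–Barnes integral along `Re s = 1`. -/
lemma hasSum_besselTerm {ν : ℝ} (hν1 : ν < 1) {p : ℕ} (hp : 1 ≤ p) {a : ℂ}
    (ha : a ≠ 0) (harg : |a.arg| < Real.pi / 2) :
    HasSum (fun n : ℕ => besselTerm ν p a (n + 1))
      ((4 * Real.pi : ℂ)⁻¹ * ∫ t : ℝ, barnesMain ν p (a / 2) (((1 : ℝ) : ℂ) + t * I)) := by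
  have hp' : (1 : ℝ) ≤ p := by exact_mod_cast hp
  have hpi : (Real.pi : ℂ) ≠ 0 := by exact_mod_cast Real.pi_ne_zero
  have hare : 0 < a.re := (Complex.abs_arg_lt_pi_div_two_iff.1 harg).resolve_right ha
  set x : ℂ := a / 2 with hx
  have hx0 : x ≠ 0 := div_ne_zero ha two_ne_zero
  have hxarg : x.arg = a.arg := by
    rw [hx, show a / 2 = ((2⁻¹ : ℝ) : ℂ) * a by push_cast; ring, Complex.arg_real_mul _ (by norm_num)]
  set F : ℕ → ℝ → ℂ := fun n t =>
    gammaPair ν ((((n + 1 : ℝ) ^ p : ℝ) : ℂ) * x) (((1 : ℝ) : ℂ) + t * I) with hF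
  have hFint : ∀ n, Integrable (F n) := fun n => by
    refine integrable_gammaPair one_pos hν1 (mul_ne_zero ?_ hx0) ?_
    · exact_mod_cast (by positivity : (n + 1 : ℝ) ^ p ≠ 0)
    · rwa [Complex.arg_real_mul _ (by positivity), hxarg]
  have hFn : ∀ n t, F n t = gammaPair ν x (((1 : ℝ) : ℂ) + t * I)
      * ((n + 1 : ℝ) : ℂ) ^ (-(2 * p * (((1 : ℝ) : ℂ) + t * I))) :=
    fun n t => gammaPair_pow_mul hx0
  -- On `Re s = 1` the norm factors into a fixed integrable function and `(n+1)^(-2p)`, which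
  -- justifies exchanging sum and integral.
  have hFnorm : ∀ n t, ‖F n t‖ = ‖gammaPair ν x (((1 : ℝ) : ℂ) + t * I)‖
      * (n + 1 : ℝ) ^ (-(2 * p) : ℝ) := by
    intro n t
    rw [hFn, norm_mul, norm_cpow_eq_rpow_re_of_pos (by positivity)]
    congr 2
    simp
  have hsumF : Summable fun n => ∫ t, ‖F n t‖ := by
    simp_rw [hFnorm, integral_mul_const]
    exact (summable_succ_rpow_neg (by linarith)).mul_left _
  have hterm : ∀ n, ∫ t, F n t = 4 * Real.pi * besselTerm ν p a (n + 1) := by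
    intro n
    have hz : 0 < (a * ((n + 1 : ℕ) : ℂ) ^ p).re := by
      have : a * ((n + 1 : ℕ) : ℂ) ^ p = (((n + 1 : ℝ) ^ p : ℝ) : ℂ) * a := by
        push_cast; ring
      rw [this, re_ofReal_mul]
      positivity
    rw [besselTerm, ← integral_Gamma_mul_Gamma_mul_cpow one_pos hν1 hz]
    refine integral_congr_ae (Eventually.of_forall fun t => ?_)
    simp only [hF, gammaPair]
    congr 2
    · rw [hx]; push_cast; ring
    · push_cast; ring
  have hts : ∀ t, ∑' n, F n t = barnesMain ν p x (((1 : ℝ) : ℂ) + t * I) := by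
    intro t
    simp_rw [hFn]
    rw [tsum_mul_left, barnesMain, zeta_eq_tsum_one_div_nat_add_one_cpow]
    · congr 2
      ext n
      rw [cpow_neg, one_div]
      push_cast
      rfl
    · have : (2 * p * (((1 : ℝ) : ℂ) + t * I)).re = 2 * p := by simp
      rw [this]; linarith
  have h := hasSum_integral_of_summable_integral_norm hFint hsumF
  simp_rw [hterm, hts] at h
  have h' := h.mul_left ((4 * Real.pi : ℂ)⁻¹)
  refine h'.congr_fun fun n => ?_
  field_simp

/-- The functional equation of `ζ` on the left line. -/
lemma barnesMain_neg {ν : ℝ} (hν : 0 ≤ ν) {p : ℕ} (hp : 1 ≤ p) {a : ℂ} (ha : a ≠ 0) {s : ℂ}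
    (hs : 0 < s.re) :
    barnesMain ν p (a / 2) (-s)
      = -Real.pi * remainderIntegrand ν p a 1 s * riemannZeta (1 + 2 * p * s) := by
  have hp' : (0 : ℝ) < p := by exact_mod_cast hp
  have hpi : (Real.pi : ℂ) ≠ 0 := by exact_mod_cast Real.pi_ne_zero
  have hre : (2 * p * s).re = 2 * p * s.re := by simp
  have hpos : 0 < (2 * p * s).re := by rw [hre]; positivity
  have hz := riemannZeta_one_sub (s := 1 + 2 * p * s)
    (ne_neg_natCast_of_re_pos (by rw [add_re, one_re]; linarith))
    (fun h => by
      have : 2 * p * s = 0 := by linear_combination h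
      rw [this] at hpos; simp at hpos)
  have h2pi : (0 : ℝ) < 2 * Real.pi := by positivity
  have h2pi' : (2 * Real.pi : ℂ) ≠ 0 := by exact_mod_cast h2pi.ne'
  have hcos : Complex.cos (Real.pi * (1 + 2 * p * s) / 2) = -Complex.sin (Real.pi * p * s) := by
    rw [show (Real.pi : ℂ) * (1 + 2 * p * s) / 2 = Real.pi * p * s + Real.pi / 2 by ring,
      Complex.cos_add_pi_div_two]
  have hb : (a / (2 * (2 * Real.pi * (1 : ℕ)) ^ p)) ^ (2 * s)
      = (2 * Real.pi : ℂ) ^ (-(2 * p * s)) * (a / 2) ^ (2 * s) := by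
    have e : a / (2 * (2 * Real.pi * ((1 : ℕ) : ℂ)) ^ p)
        = ((((2 * Real.pi) ^ p)⁻¹ : ℝ) : ℂ) * (a / 2) := by
      push_cast; field_simp
    rw [e, ofReal_mul_cpow (by positivity) (div_ne_zero ha two_ne_zero), ofReal_inv_pow_cpow h2pi,
      show (p : ℂ) * (2 * s) = 2 * p * s by ring]
    push_cast
    rfl
  have hpw : (2 * Real.pi : ℂ) ^ (-(1 + 2 * p * s))
      = (2 * Real.pi : ℂ)⁻¹ * (2 * Real.pi : ℂ) ^ (-(2 * p * s)) := by
    rw [neg_add, cpow_add _ _ h2pi', cpow_neg_one]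
  rw [barnesMain, gammaPair, remainderIntegrand_eq hν p a 1 hs, hb,
    show (2 : ℂ) * p * -s = 1 - (1 + 2 * p * s) by ring, hz, hcos, hpw,
    show (-2 : ℂ) * -s = 2 * s by ring]
  field_simp

lemma remainderIntegrand_succ {ν : ℝ} (p : ℕ) {a : ℂ} (ha : a ≠ 0) (k : ℕ) (s : ℂ) :
    remainderIntegrand ν p a (k + 1) s
      = remainderIntegrand ν p a 1 s * ((k + 1 : ℝ) : ℂ) ^ (-(2 * p * s)) := by
  have e : a / (2 * (2 * Real.pi * ((k + 1 : ℕ) : ℂ)) ^ p)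
      = ((((k + 1 : ℝ) ^ p)⁻¹ : ℝ) : ℂ) * (a / (2 * (2 * Real.pi * ((1 : ℕ) : ℂ)) ^ p)) := by
    push_cast; field_simp
    rw [mul_pow (2 * (Real.pi : ℂ))]; ring
  rw [remainderIntegrand, remainderIntegrand, e, ofReal_mul_cpow (by positivity)
    (componentBase_ne_zero p ha le_rfl), ofReal_inv_pow_cpow (by positivity),
    show (p : ℂ) * (2 * s) = 2 * p * s by ring]
  ring

/-- Expansion of the Mellin–Barnes integral on the left line into component integrals. -/
lemma hasSum_component_integral {ν : ℝ} (hν0 : 0 ≤ ν) (hν1 : ν < 1) {p : ℕ} (hp : 1 ≤ p) {a : ℂ}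
    (ha : a ≠ 0) (harg : |a.arg| < Real.pi / 2) {A : ℝ} (hA0 : 0 < A) (hA1 : A < 1 - ν) :
    HasSum (fun k : ℕ => 1 / ((k + 1 : ℕ) : ℂ) * (-(1 / 4) *
        ∫ t : ℝ, remainderIntegrand ν p a (k + 1) ((A : ℂ) + t * I)))
      ((4 * Real.pi : ℂ)⁻¹ * ∫ t : ℝ, barnesMain ν p (a / 2) (((-A : ℝ) : ℂ) + t * I)) := by
  have hp' : (0 : ℝ) < p := by exact_mod_cast hp
  have hpi : (Real.pi : ℂ) ≠ 0 := by exact_mod_cast Real.pi_ne_zero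
  set F : ℕ → ℝ → ℂ := fun k t => 1 / ((k + 1 : ℕ) : ℂ) * (-(1 / 4) *
    remainderIntegrand ν p a (k + 1) ((A : ℂ) + t * I)) with hF
  have hFint : ∀ k, Integrable (F k) := fun k =>
    ((integrable_remainderIntegrand hν0 hν1 hp ha harg (N := 1) (by omega) hA0
      (by push_cast; linarith) (by push_cast; linarith)).const_mul _).const_mul _
  have hre : ∀ t : ℝ, (2 * p * ((A : ℂ) + t * I)).re = 2 * p * A := fun t => by simp
  have hFn : ∀ k t, F k t = -(1 / 4) * remainderIntegrand ν p a 1 ((A : ℂ) + t * I)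
      * (1 / ((k : ℂ) + 1) ^ (1 + 2 * p * ((A : ℂ) + t * I))) := by
    intro k t
    have hk : ((k : ℂ) + 1) ≠ 0 := by exact_mod_cast (by positivity : (k + 1 : ℝ) ≠ 0)
    simp only [hF]
    rw [remainderIntegrand_succ p ha, one_div (_ ^ _), ← cpow_neg, neg_add, cpow_add _ _ hk,
      cpow_neg_one]
    push_cast
    ring
  -- The weight `1/k` combines with `k^(-2pA)`, so any `A > 0` gives absolute convergence.
  have hFnorm : ∀ k t, ‖F k t‖ = ‖(-(1 / 4) : ℂ) * remainderIntegrand ν p a 1 ((A : ℂ) + t * I)‖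
      * (k + 1 : ℝ) ^ (-(1 + 2 * p * A) : ℝ) := by
    intro k t
    rw [hFn, norm_mul, one_div (_ ^ _), ← cpow_neg]
    congr 1
    have : ((k : ℂ) + 1) = ((k + 1 : ℝ) : ℂ) := by push_cast; rfl
    rw [this, norm_cpow_eq_rpow_re_of_pos (by positivity), neg_re, add_re, one_re, hre]
  have hsumF : Summable fun k => ∫ t, ‖F k t‖ := by
    simp_rw [hFnorm, integral_mul_const]
    exact (summable_succ_rpow_neg (by
      have : 0 < 2 * (p : ℝ) * A := by positivity
      linarith)).mul_left _
  have hts : ∀ t : ℝ, ∑' k, F k t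
      = (4 * Real.pi : ℂ)⁻¹ * barnesMain ν p (a / 2) (-((A : ℂ) + t * I)) := by
    intro t
    simp_rw [hFn]
    rw [tsum_mul_left, ← zeta_eq_tsum_one_div_nat_add_one_cpow, barnesMain_neg hν0 hp ha (by simpa)]
    · field_simp
    · rw [add_re, one_re, hre]
      have : 0 < 2 * (p : ℝ) * A := by positivity
      linarith
  have h := hasSum_integral_of_summable_integral_norm hFint hsumF
  have hneg : ∫ t : ℝ, barnesMain ν p (a / 2) (((-A : ℝ) : ℂ) + t * I)
      = ∫ t : ℝ, barnesMain ν p (a / 2) (-((A : ℂ) + t * I)) := by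
    rw [← integral_neg_eq_self]
    refine integral_congr_ae (Eventually.of_forall fun t => ?_)
    simp only
    congr 1
    push_cast
    ring
  simp_rw [hts] at h
  rw [integral_const_mul, ← hneg] at h
  simpa only [hF, integral_const_mul] using h

/-! ### Residues between the two lines -/

open Asymptotics in
-- First-order Taylor expansion of the numerator: its value and derivative are the two Laurent
-- coefficients of a double pole.
lemma isLittleO_of_hasDerivAt_div_sq {f h : ℂ → ℂ} {c h' : ℂ} (hh : HasDerivAt h h' c)
    (hf : ∀ᶠ z in 𝓝[≠] c, f z = h z / (z - c) ^ 2) :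
    (fun z => f z - (h c * ((z - c) ^ 2)⁻¹ + h' * (z - c)⁻¹)) =o[𝓝[≠] c] fun z => (z - c)⁻¹ := by
  refine (isLittleO_iff_tendsto' ?_).2 ?_
  · filter_upwards [self_mem_nhdsWithin] with z hz h0
    exact absurd h0 (inv_ne_zero (sub_ne_zero.2 hz))
  · have := (hasDerivAt_iff_tendsto_slope.1 hh).sub_const h'
    rw [sub_self] at this
    refine this.congr' ?_
    filter_upwards [self_mem_nhdsWithin, hf] with z hz hfz
    have := sub_ne_zero.2 hz
    rw [hfz, slope_def_field]
    field_simp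
    ring

/-- Shift of the Mellin–Barnes contour from `Re s = 1` to `Re s = -A`. -/
lemma integral_barnesMain_shift {ν : ℝ} (hν0 : 0 ≤ ν) {p : ℕ} (hp : 1 ≤ p) {x : ℂ}
    (hx : x ≠ 0) (harg : |x.arg| < Real.pi / 2) {A : ℝ} (hA0 : 0 < A) (hA1 : A < 1 - ν)
    (S : Finset ℝ) (q r : ℝ → ℂ) (hS0 : 0 ∈ S) (hSν : ν ∈ S) (hSμ : 1 / (2 * p : ℝ) ∈ S)
    (hS : ∀ y ∈ S, 0 ≤ y ∧ y < 1)
    (hpole : ∀ y ∈ S, (fun z => barnesMain ν p x z - (q y * ((z - y) ^ 2)⁻¹ + r y * (z - y)⁻¹))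
      =o[𝓝[≠] (y : ℂ)] fun z => (z - y)⁻¹) :
    (4 * Real.pi : ℂ)⁻¹ * ∫ t : ℝ, barnesMain ν p x (((1 : ℝ) : ℂ) + t * I)
      = 1 / 2 * ∑ y ∈ S, r y
        + (4 * Real.pi : ℂ)⁻¹ * ∫ t : ℝ, barnesMain ν p x (((-A : ℝ) : ℂ) + t * I) := by
  have hp0 : (p : ℂ) ≠ 0 := by exact_mod_cast (by omega : p ≠ 0)
  have hpi : (Real.pi : ℂ) ≠ 0 := by exact_mod_cast Real.pi_ne_zero
  have h := (integral_vertical_sub_integral_vertical (f := barnesMain ν p x) (A := -A) (B := 1)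
    (by linarith) S q r (fun y hy => ⟨by linarith [(hS y hy).1], (hS y hy).2⟩) ?_ hpole
    (sub_pos.2 harg) (stripBound_barnesMain ν hp hx harg _ _)).2.2
  · rw [sub_eq_iff_eq_add] at h
    rw [h]
    generalize ∫ t : ℝ, barnesMain ν p x (((-A : ℝ) : ℂ) + t * I) = J
    field_simp
    ring
  · intro z h1 h2 h3
    -- The further poles `y-m` with `m ≥ 1` satisfy `y-m ≤ ν-1 < -A`, outside the strip.
    have hΓ : ∀ y : ℝ, 0 ≤ y → y ≤ ν → z ≠ y → ∀ m : ℕ, z - y ≠ -m := by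
      intro y hy0 hy1 hzy m hm
      rcases Nat.eq_zero_or_pos m with rfl | hm0
      · exact hzy (by linear_combination hm + (by simp : -((0 : ℕ) : ℂ) = 0))
      · have hre := congrArg Complex.re hm
        simp only [sub_re, ofReal_re, neg_re, natCast_re] at hre
        have : (1 : ℝ) ≤ m := by exact_mod_cast hm0
        linarith
    refine DifferentiableAt.mul (differentiableAt_gammaPair hx ?_ ?_) ?_
    · intro m
      have := hΓ 0 le_rfl hν0 (h3 0 hS0) m
      simpa using this
    · exact hΓ ν hν0 le_rfl (h3 ν hSν)
    · refine DifferentiableAt.fun_comp' z (differentiableAt_riemannZeta fun h => ?_) (by fun_prop)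
      refine h3 _ hSμ ?_
      push_cast
      field_simp
      linear_combination h

lemma Gamma_eq_div {s : ℂ} (hs : s ≠ 0) : Complex.Gamma s = Complex.Gamma (s + 1) / s := by
  rw [Complex.Gamma_add_one s hs, mul_div_cancel_left₀ _ hs]

lemma riemannZeta_two_mul_eq_div {p : ℕ} (hp : 1 ≤ p) {z : ℂ} (hz : z ≠ ((1 / (2 * p) : ℝ) : ℂ)) :
    riemannZeta (2 * p * z)
      = riemannZeta₁ (2 * p * z) / (2 * p) / (z - ((1 / (2 * p) : ℝ) : ℂ)) := by
  have hp0 : (p : ℂ) ≠ 0 := by exact_mod_cast (by omega : p ≠ 0)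
  have hz' := sub_ne_zero.2 hz
  have e : 2 * p * z - 1 = 2 * p * (z - ((1 / (2 * p) : ℝ) : ℂ)) := by
    push_cast; field_simp
  have hne : 2 * p * z ≠ 1 := by
    intro h
    rw [h, sub_self] at e
    exact mul_ne_zero (mul_ne_zero two_ne_zero hp0) hz' e.symm
  rw [riemannZeta_eq_inv_sub_mul hne, e]
  field_simp


/-- The inner `-1/2` is `ζ(0)`, the outer `1/2` is `2π/(4π)`; the rest is the reflection formula. -/
lemma half_residue_zero {ν : ℝ} (hν : 0 < ν) :
    1 / 2 * (-(1 / 2) * Complex.Gamma (-ν))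
      = Real.pi / Complex.sin (Real.pi * ν) / (4 * Complex.Gamma (1 + ν)) := by
  have hpi : (Real.pi : ℂ) ≠ 0 := by exact_mod_cast Real.pi_ne_zero
  have h := inv_Gamma_mul_inv_sin (s := ν)
    (Complex.Gamma_ne_zero_of_re_pos (by simp; linarith))
  rw [div_eq_mul_inv, div_eq_mul_inv, mul_inv]
  have h' : Complex.Gamma (-ν) = -Real.pi * ((Complex.Gamma (1 + ν))⁻¹
      * (Complex.sin (Real.pi * ν))⁻¹) := by
    rw [h]; field_simp
  rw [h']
  ring

lemma continuousAt_cpow_neg_two_mul {x : ℂ} (hx : x ≠ 0) (z : ℂ) :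
    ContinuousAt (fun s : ℂ => x ^ (-2 * s)) z :=
  (DifferentiableAt.const_cpow (by fun_prop : DifferentiableAt ℂ (fun s : ℂ => -2 * s) z)
    (Or.inl hx)).continuousAt

lemma neg_ofReal_ne_neg_natCast {ν : ℝ} (hν0 : 0 < ν) (hν1 : ν < 1) (m : ℕ) :
    (-(ν : ℂ)) ≠ -m := by
  intro h
  have h' : ν = m := by exact_mod_cast neg_injective h
  rcases Nat.eq_zero_or_pos m with rfl | hm
  · simp at h'; linarith
  · have : (1 : ℝ) ≤ m := by exact_mod_cast hm
    linarith

/-- Simple pole at `0`. -/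
lemma tendsto_barnesMain_zero {ν : ℝ} (hν0 : 0 < ν) (hν1 : ν < 1) (p : ℕ) {x : ℂ} (hx : x ≠ 0) :
    Tendsto (fun z => (z - 0) * barnesMain ν p x z) (𝓝[≠] (0 : ℂ))
      (𝓝 (-(1 / 2) * Complex.Gamma (-ν))) := by
  have hc : ContinuousAt (fun z : ℂ => Complex.Gamma (z + 1) * Complex.Gamma (z - ν)
      * x ^ (-2 * z) * riemannZeta (2 * p * z)) 0 := by
    refine ContinuousAt.mul (ContinuousAt.mul (ContinuousAt.mul ?_ ?_)
      (continuousAt_cpow_neg_two_mul hx 0)) ?_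
    · refine ((differentiableAt_Gamma_of_re_pos ?_).fun_comp' (0 : ℂ) (by fun_prop)).continuousAt
      simp
    · refine ((Complex.differentiableAt_Gamma _ ?_).fun_comp' (0 : ℂ) (by fun_prop)).continuousAt
      rw [zero_sub]
      exact neg_ofReal_ne_neg_natCast hν0 hν1
    · refine ((differentiableAt_riemannZeta ?_).fun_comp' (0 : ℂ) (by fun_prop)).continuousAt
      simp
  have h := hc.tendsto.mono_left (nhdsWithin_le_nhds (s := {0}ᶜ))
  simp only [zero_add, Complex.Gamma_one, zero_sub, mul_zero, cpow_zero, riemannZeta_zero,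
    one_mul, mul_one] at h
  rw [show Complex.Gamma (-ν) * (-1 / 2) = -(1 / 2) * Complex.Gamma (-ν) by ring] at h
  refine h.congr' ?_
  filter_upwards [self_mem_nhdsWithin] with z hz
  have hz : z ≠ 0 := hz
  rw [barnesMain, gammaPair, Gamma_eq_div hz, sub_zero]
  field_simp

/-- Simple pole at `ν`. -/
lemma tendsto_barnesMain_order {ν : ℝ} (hν0 : 0 < ν) {p : ℕ} (hp : 1 ≤ p)
    (hνp : ν ≠ 1 / (2 * p)) {x : ℂ} (hx : x ≠ 0) :
    Tendsto (fun z => (z - ν) * barnesMain ν p x z) (𝓝[≠] (ν : ℂ))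
      (𝓝 (Complex.Gamma ν * x ^ (-2 * ν : ℂ) * riemannZeta (2 * p * ν))) := by
  have hp0 : (p : ℝ) ≠ 0 := by exact_mod_cast (by omega : p ≠ 0)
  have hc : ContinuousAt (fun z : ℂ => Complex.Gamma z * Complex.Gamma (z - ν + 1)
      * x ^ (-2 * z) * riemannZeta (2 * p * z)) ν := by
    refine ContinuousAt.mul (ContinuousAt.mul (ContinuousAt.mul ?_ ?_)
      (continuousAt_cpow_neg_two_mul hx _)) ?_
    · exact (differentiableAt_Gamma_of_re_pos (by simpa)).continuousAt
    · refine ((differentiableAt_Gamma_of_re_pos ?_).fun_comp' (ν : ℂ) (by fun_prop)).continuousAt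
      simp
    · refine ((differentiableAt_riemannZeta fun h => hνp ?_).fun_comp' (ν : ℂ)
        (by fun_prop)).continuousAt
      have h' : 2 * p * ν = 1 := by exact_mod_cast h
      field_simp
      linarith
  have h := hc.tendsto.mono_left (nhdsWithin_le_nhds (s := {(ν : ℂ)}ᶜ))
  simp only [sub_self, zero_add, Complex.Gamma_one, mul_one] at h
  refine h.congr' ?_
  filter_upwards [self_mem_nhdsWithin] with z hz
  have hz := sub_ne_zero.2 hz
  rw [barnesMain, gammaPair, Gamma_eq_div hz]
  field_simp

/-- Simple pole at `1 / (2p)`. -/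
lemma tendsto_barnesMain_zeta {ν : ℝ} (hν1 : ν < 1) {p : ℕ} (hp : 1 ≤ p)
    (hνp : ν ≠ 1 / (2 * p)) {x : ℂ} (hx : x ≠ 0) :
    Tendsto (fun z => (z - ((1 / (2 * p) : ℝ) : ℂ)) * barnesMain ν p x z)
      (𝓝[≠] ((1 / (2 * p) : ℝ) : ℂ))
      (𝓝 (1 / (2 * p) * Complex.Gamma (1 / (2 * p)) * Complex.Gamma (1 / (2 * p) - ν)
          * x ^ (-(1 / p) : ℂ))) := by
  have hp0 : (p : ℂ) ≠ 0 := by exact_mod_cast (by omega : p ≠ 0)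
  have hp1 : (0 : ℝ) < p := by exact_mod_cast hp
  set μ : ℝ := 1 / (2 * p) with hμ
  have hμ0 : 0 < μ := by positivity
  have hμc : (μ : ℂ) = 1 / (2 * p) := by rw [hμ]; push_cast; rfl
  -- The numerator after the pole of `ζ` is divided out; `riemannZeta₁` equals `1` at `1`.
  have hc : ContinuousAt (fun z : ℂ => Complex.Gamma z * Complex.Gamma (z - ν)
      * x ^ (-2 * z) * (riemannZeta₁ (2 * p * z) / (2 * p))) μ := by
    refine ContinuousAt.mul (ContinuousAt.mul (ContinuousAt.mul ?_ ?_)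
      (continuousAt_cpow_neg_two_mul hx _)) ?_
    · exact (differentiableAt_Gamma_of_re_pos (by simpa)).continuousAt
    · refine ((Complex.differentiableAt_Gamma _ fun m h => ?_).fun_comp' (μ : ℂ)
        (by fun_prop)).continuousAt
      have h' : μ - ν = -m := by exact_mod_cast h
      rcases Nat.eq_zero_or_pos m with rfl | hm
      · simp at h'; exact hνp (by linarith)
      · have : (1 : ℝ) ≤ m := by exact_mod_cast hm
        linarith
    · exact (differentiable_riemannZeta₁.continuous.comp
        (by fun_prop : Continuous fun z : ℂ => 2 * p * z)).continuousAt.div_const _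
  have h := hc.tendsto.mono_left (nhdsWithin_le_nhds (s := {(μ : ℂ)}ᶜ))
  have e1 : (2 : ℂ) * p * μ = 1 := by rw [hμc]; field_simp
  have e2 : (-2 : ℂ) * μ = -(1 / p) := by rw [hμc]; field_simp
  rw [e1, e2, riemannZeta₁_one, hμc] at h
  rw [show Complex.Gamma (1 / (2 * p)) * Complex.Gamma (1 / (2 * p) - ν) * x ^ (-(1 / p) : ℂ)
    * (1 / (2 * p)) = 1 / (2 * p) * Complex.Gamma (1 / (2 * p)) * Complex.Gamma (1 / (2 * p) - ν)
          * x ^ (-(1 / p) : ℂ) by ring, ← hμc] at h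
  rw [← hμc]
  refine h.congr' ?_
  filter_upwards [self_mem_nhdsWithin] with z hz
  have hz' := sub_ne_zero.2 hz
  rw [barnesMain, gammaPair, riemannZeta_two_mul_eq_div hp hz, ← hμ]
  field_simp

lemma hasDerivAt_cpow_neg_two_mul {x : ℂ} (hx : x ≠ 0) (z : ℂ) :
    HasDerivAt (fun s : ℂ => x ^ (-2 * s)) (x ^ (-2 * z) * Complex.log x * -2) z := by
  have h : HasDerivAt (fun s : ℂ => -2 * s) (-2) z := by
    simpa using (hasDerivAt_id z).const_mul (-2 : ℂ)
  exact h.const_cpow (Or.inl hx)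

/-- Numerator of the double pole at `0` for `ν = 0`. -/
lemma hasDerivAt_numerator_zero (p : ℕ) {x : ℂ} (hx : x ≠ 0) :
    HasDerivAt (fun z : ℂ => Complex.Gamma (z + 1) * Complex.Gamma (z + 1) * x ^ (-2 * z)
      * riemannZeta (2 * p * z))
      ((Real.eulerMascheroniConstant : ℂ) + Complex.log x - p * (Real.log (2 * Real.pi) : ℂ)) 0 := by
  have hG : HasDerivAt (fun z : ℂ => Complex.Gamma (z + 1))
      (-(Real.eulerMascheroniConstant : ℂ)) 0 :=
    HasDerivAt.comp_add_const 0 1 (by rw [zero_add]; exact Complex.hasDerivAt_Gamma_one)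
  have hz : HasDerivAt (fun z : ℂ => riemannZeta (2 * p * z))
      (-Complex.log (2 * Real.pi) / 2 * (2 * p)) 0 := by
    have h1 : HasDerivAt riemannZeta (-Complex.log (2 * Real.pi) / 2) (2 * p * 0) := by
      rw [mul_zero, ← deriv_riemannZeta_zero]
      exact (differentiableAt_riemannZeta (by simp)).hasDerivAt
    have h2 : HasDerivAt (fun z : ℂ => 2 * p * z) (2 * p) 0 := by
      simpa using (hasDerivAt_id (0 : ℂ)).const_mul (2 * p : ℂ)
    exact h1.comp 0 h2
  -- With `ζ(0) = -1/2`, the two factors `Γ'(1) = -γ` give `γ`, the power gives `log x`, and `ζ'(0)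
  -- = -(log 2π)/2` with inner derivative `2p` gives `-p log 2π`.
  refine (((hG.fun_mul hG).fun_mul (hasDerivAt_cpow_neg_two_mul hx 0)).fun_mul hz).congr_deriv ?_
  have hlog : Complex.log (2 * Real.pi) = (Real.log (2 * Real.pi) : ℂ) := by
    rw [ofReal_log (by positivity)]; push_cast; rfl
  simp only [zero_add, Complex.Gamma_one, mul_zero, cpow_zero, riemannZeta_zero, hlog]
  ring

/-- Numerator of the double pole at `ν = 1 / (2p)`. -/
lemma hasDerivAt_numerator_zeta {p : ℕ} (hp : 1 ≤ p) {x : ℂ} (hx : x ≠ 0) :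
    HasDerivAt (fun z : ℂ => Complex.Gamma z * Complex.Gamma (z - ((1 / (2 * p) : ℝ) : ℂ) + 1)
      * x ^ (-2 * z) * (riemannZeta₁ (2 * p * z) / (2 * p)))
      (1 / (2 * p) * Complex.Gamma (1 / (2 * p)) * x ^ (-(1 / p) : ℂ)
        * (Complex.digamma (1 / (2 * p)) - 2 * Complex.log x
            + (2 * p - 1) * (Real.eulerMascheroniConstant : ℂ))) ((1 / (2 * p) : ℝ) : ℂ) := by
  have hp0 : (p : ℂ) ≠ 0 := by exact_mod_cast (by omega : p ≠ 0)
  have hp1 : (0 : ℝ) < p := by exact_mod_cast hp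
  set μ : ℝ := 1 / (2 * p) with hμ
  have hμ0 : 0 < μ := by positivity
  have hμc : (μ : ℂ) = 1 / (2 * p) := by rw [hμ]; push_cast; rfl
  have e1 : (2 : ℂ) * p * μ = 1 := by rw [hμc]; field_simp
  have e2 : (-2 : ℂ) * μ = -(1 / p) := by rw [hμc]; field_simp
  have hΓ0 : Complex.Gamma μ ≠ 0 := Complex.Gamma_ne_zero_of_re_pos (by simpa)
  have h1 : HasDerivAt Complex.Gamma (Complex.digamma μ * Complex.Gamma μ) μ := by
    rw [Complex.digamma_def, logDeriv_apply, div_mul_cancel₀ _ hΓ0]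
    exact (differentiableAt_Gamma_of_re_pos (by simpa)).hasDerivAt
  have h2 : HasDerivAt (fun z : ℂ => Complex.Gamma (z - μ + 1))
      (-(Real.eulerMascheroniConstant : ℂ)) μ := by
    have h := Complex.hasDerivAt_Gamma_one
    refine HasDerivAt.comp_sub_const (μ : ℂ) (μ : ℂ) (f := fun z => Complex.Gamma (z + 1)) ?_
    exact HasDerivAt.comp_add_const _ 1 (by rw [sub_self, zero_add]; exact h)
  have h3 : HasDerivAt (fun z : ℂ => riemannZeta₁ (2 * p * z) / (2 * p))
      (Real.eulerMascheroniConstant : ℂ) μ := by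
    have h4 : HasDerivAt riemannZeta₁ (Real.eulerMascheroniConstant : ℂ) (2 * p * μ) := by
      rw [e1, ← deriv_riemannZeta₁_one]
      exact (differentiable_riemannZeta₁ 1).hasDerivAt
    have h5 : HasDerivAt (fun z : ℂ => 2 * p * z) (2 * p) (μ : ℂ) := by
      simpa using (hasDerivAt_id (μ : ℂ)).const_mul (2 * p : ℂ)
    refine ((h4.comp (μ : ℂ) h5).div_const (2 * p : ℂ)).congr_deriv ?_
    field_simp
  -- In logarithmic derivatives, `Γ(z-μ+1)` contributes `-γ` and the zeta factor `2pγ`, whence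
  -- `(2p-1)γ`.
  refine (((h1.fun_mul h2).fun_mul (hasDerivAt_cpow_neg_two_mul hx μ)).fun_mul h3).congr_deriv ?_
  rw [sub_self, zero_add, Complex.Gamma_one, e1, e2, riemannZeta₁_one, ← hμc]
  have hμ3 : (μ : ℂ) * (2 * p) = 1 := by rw [← e1]; ring
  linear_combination (-(Complex.Gamma μ * x ^ (-(1 / p) : ℂ)
    * (Real.eulerMascheroniConstant : ℂ))) * hμ3

/-- The residues of the Mellin–Barnes integrand between the two lines add up to `residuePart`. -/
lemma integral_barnesMain_eq_residuePart {ν : ℝ} (hν0 : 0 ≤ ν) (hν1 : ν < 1) {p : ℕ} (hp : 1 ≤ p)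
    {a : ℂ} (ha : a ≠ 0) (harg : |a.arg| < Real.pi / 2) {A : ℝ} (hA0 : 0 < A) (hA1 : A < 1 - ν) :
    (4 * Real.pi : ℂ)⁻¹ * ∫ t : ℝ, barnesMain ν p (a / 2) (((1 : ℝ) : ℂ) + t * I)
      = residuePart ν p a
        + (4 * Real.pi : ℂ)⁻¹ * ∫ t : ℝ, barnesMain ν p (a / 2) (((-A : ℝ) : ℂ) + t * I) := by
  have hp0 : (p : ℂ) ≠ 0 := by exact_mod_cast (by omega : p ≠ 0)
  have hp1 : (1 : ℝ) ≤ p := by exact_mod_cast hp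
  have hx : a / 2 ≠ 0 := div_ne_zero ha two_ne_zero
  have hxarg : |(a / 2).arg| < Real.pi / 2 := by
    rwa [show a / 2 = ((2⁻¹ : ℝ) : ℂ) * a by push_cast; ring, Complex.arg_real_mul _ (by norm_num)]
  have hμ0 : (0 : ℝ) < 1 / (2 * p) := by positivity
  have hμ1 : (1 : ℝ) / (2 * p) < 1 := by rw [div_lt_one (by positivity)]; linarith
  rw [residuePart]
  split_ifs with h0 hμ
  · subst h0
    -- For `ν = 0` the poles of both Gamma factors merge at `0`, with leading coefficient `ζ(0) =
    -- -1/2`; the pole of `ζ` stays simple.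
    rw [integral_barnesMain_shift le_rfl hp hx hxarg hA0 hA1 {0, (1 / (2 * p) : ℝ)}
      (fun y => if y = 0 then -(1 / 2) else 0)
      (fun y => if y = 0 then (Real.eulerMascheroniConstant : ℂ) + Complex.log (a / 2)
          - p * (Real.log (2 * Real.pi) : ℂ)
        else 1 / (2 * p) * Complex.Gamma (1 / (2 * p)) * Complex.Gamma (1 / (2 * p) - (0 : ℝ))
          * (a / 2) ^ (-(1 / p) : ℂ)) (by simp) (by simp) (by simp) ?_ ?_]
    · rw [Finset.sum_pair hμ0.ne, if_pos rfl, if_neg hμ0.ne']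
      simp only [ofReal_zero, sub_zero]
      congr 1
      field_simp
      ring
    · intro y hy
      simp only [Finset.mem_insert, Finset.mem_singleton] at hy
      rcases hy with rfl | rfl
      · exact ⟨le_rfl, one_pos⟩
      · exact ⟨hμ0.le, hμ1⟩
    · intro y hy
      simp only [Finset.mem_insert, Finset.mem_singleton] at hy
      rcases hy with rfl | rfl
      · rw [if_pos rfl, if_pos rfl, ofReal_zero]
        have := isLittleO_of_hasDerivAt_div_sq (f := barnesMain 0 p (a / 2))
          (hasDerivAt_numerator_zero p hx) ?_
        · simpa [riemannZeta_zero, neg_div] using this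
        · filter_upwards [self_mem_nhdsWithin] with z hz
          have hz : z ≠ 0 := hz
          rw [barnesMain, gammaPair, ofReal_zero, sub_zero, Gamma_eq_div hz]
          field_simp
      · rw [if_neg hμ0.ne', if_neg hμ0.ne']
        exact isLittleO_of_tendsto_sub_mul (tendsto_barnesMain_zeta hν1 hp hμ0.ne hx)
  · have hν : 0 < ν := lt_of_le_of_ne hν0 (Ne.symm h0)
    -- For `ν = 1/(2p)` the pole of `Γ(s-ν)` merges with that of `ζ`; the pole at `0` stays simple.
    rw [integral_barnesMain_shift hν0 hp hx hxarg hA0 hA1 {0, (1 / (2 * p) : ℝ)}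
      (fun y => if y = 0 then 0 else Complex.Gamma (1 / (2 * p)) * (a / 2) ^ (-(1 / p) : ℂ)
        * (1 / (2 * p)))
      (fun y => if y = 0 then -(1 / 2) * Complex.Gamma (-ν)
        else 1 / (2 * p) * Complex.Gamma (1 / (2 * p)) * (a / 2) ^ (-(1 / p) : ℂ)
        * (Complex.digamma (1 / (2 * p)) - 2 * Complex.log (a / 2)
            + (2 * p - 1) * (Real.eulerMascheroniConstant : ℂ)))
      (by simp) (by simp [hμ]) (by simp) ?_ ?_]
    · rw [Finset.sum_pair hμ0.ne, if_pos rfl, if_neg hμ0.ne', mul_add, half_residue_zero hν, hμ]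
      push_cast
      rw [mul_one_div (Real.pi : ℂ) (2 * p)]
      ring
    · intro y hy
      simp only [Finset.mem_insert, Finset.mem_singleton] at hy
      rcases hy with rfl | rfl
      · exact ⟨le_rfl, one_pos⟩
      · exact ⟨hμ0.le, hμ1⟩
    · intro y hy
      simp only [Finset.mem_insert, Finset.mem_singleton] at hy
      rcases hy with rfl | rfl
      · rw [if_pos rfl, if_pos rfl, ofReal_zero]
        exact isLittleO_of_tendsto_sub_mul (tendsto_barnesMain_zero hν hν1 p hx)
      · rw [if_neg hμ0.ne', if_neg hμ0.ne']
        have := isLittleO_of_hasDerivAt_div_sq (f := barnesMain ν p (a / 2))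
          (hasDerivAt_numerator_zeta hp hx) ?_
        · have e1 : (2 : ℂ) * p * ((1 / (2 * p) : ℝ) : ℂ) = 1 := by push_cast; field_simp
          have e2 : (-2 : ℂ) * ((1 / (2 * p) : ℝ) : ℂ) = -(1 / p) := by push_cast; field_simp
          have e3 : ((1 / (2 * p) : ℝ) : ℂ) = 1 / (2 * p) := by push_cast; rfl
          rw [sub_self, zero_add, Complex.Gamma_one, e1, e2, riemannZeta₁_one, mul_one, e3] at this
          rw [e3]
          exact this
        · filter_upwards [self_mem_nhdsWithin] with z hz
          have hz' := sub_ne_zero.2 hz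
          rw [barnesMain, gammaPair, riemannZeta_two_mul_eq_div hp hz, hμ, Gamma_eq_div hz']
          field_simp
  · have hν : 0 < ν := lt_of_le_of_ne hν0 (Ne.symm h0)
    have h1 : (0 : ℝ) ∉ ({ν, 1 / (2 * p : ℝ)} : Finset ℝ) := by
      simp only [Finset.mem_insert, Finset.mem_singleton, not_or]
      exact ⟨hν.ne, hμ0.ne⟩
    rw [integral_barnesMain_shift hν0 hp hx hxarg hA0 hA1 {0, ν, (1 / (2 * p) : ℝ)} 0
      (fun y => if y = 0 then -(1 / 2) * Complex.Gamma (-ν)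
        else if y = ν then Complex.Gamma ν * (a / 2) ^ (-2 * ν : ℂ) * riemannZeta (2 * p * ν)
        else 1 / (2 * p) * Complex.Gamma (1 / (2 * p)) * Complex.Gamma (1 / (2 * p) - ν)
          * (a / 2) ^ (-(1 / p) : ℂ)) (by simp) (by simp) (by simp) ?_ ?_]
    · rw [Finset.sum_insert h1, Finset.sum_pair hμ, if_pos rfl, if_neg h0, if_pos rfl,
        if_neg hμ0.ne', if_neg (Ne.symm hμ), mul_add, half_residue_zero hν]
      ring
    · intro y hy
      simp only [Finset.mem_insert, Finset.mem_singleton] at hy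
      rcases hy with rfl | rfl | rfl
      · exact ⟨le_rfl, one_pos⟩
      · exact ⟨hν0, hν1⟩
      · exact ⟨hμ0.le, hμ1⟩
    · intro y hy
      simp only [Finset.mem_insert, Finset.mem_singleton] at hy
      rcases hy with rfl | rfl | rfl
      · rw [if_pos rfl, ofReal_zero]
        exact isLittleO_of_tendsto_sub_mul (tendsto_barnesMain_zero hν hν1 p hx)
      · rw [if_neg h0, if_pos rfl]
        exact isLittleO_of_tendsto_sub_mul (tendsto_barnesMain_order hν hp hμ hx)
      · rw [if_neg hμ0.ne', if_neg (Ne.symm hμ)]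
        exact isLittleO_of_tendsto_sub_mul (tendsto_barnesMain_zeta hν1 hp hμ hx)

end

/-! ### Assembly of the expansion -/

theorem theorem1 (ν : ℝ) (hν0 : 0 ≤ ν) (hν1 : ν < 1) (p : ℕ) (hp : 2 ≤ p)
    (a : ℂ) (ha : a ≠ 0) (harg : |a.arg| < Real.pi / 2)
    (N : ℕ → ℕ) (hN : ∀ k, 1 ≤ k → 1 ≤ N k)
    (c : ℕ → ℝ) (hc0 : ∀ k, 1 ≤ k → 0 < c k) (hc1 : ∀ k, 1 ≤ k → c k < 1)
    (hcN : ∀ k, 1 ≤ k → N k = 1 → c k < 1 - ν) :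
    Summable (fun n : ℕ => besselTerm ν p a (n + 1)) ∧
    (∀ k, 1 ≤ k →
      Integrable (fun t : ℝ => remainderIntegrand ν p a k (pathPoint ν (N k) (c k) t))) ∧
    Summable (fun k : ℕ => 1 / ((k + 1 : ℕ) : ℂ) *
      (componentSeries ν p a (k + 1) (N (k + 1))
        + remainder ν p a (k + 1) (N (k + 1)) (c (k + 1)))) ∧
    besselSum ν p a = residuePart ν p a + ∑' k : ℕ, 1 / ((k + 1 : ℕ) : ℂ) *
      (componentSeries ν p a (k + 1) (N (k + 1))
        + remainder ν p a (k + 1) (N (k + 1)) (c (k + 1))) := by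
  have hp1 : 1 ≤ p := by omega
  -- The midpoint serves as the auxiliary abscissa; any point of `(0, 1-ν)` would do, and it
  -- disappears from the result.
  have hA0 : 0 < (1 - ν) / 2 := by linarith
  have hA1 : (1 - ν) / 2 < 1 - ν := by linarith
  have hleft := hasSum_besselTerm hν1 hp1 ha harg
  have hright := hasSum_component_integral hν0 hν1 hp1 ha harg hA0 hA1
  have hcomp : ∀ k : ℕ, componentSeries ν p a (k + 1) (N (k + 1))
      + remainder ν p a (k + 1) (N (k + 1)) (c (k + 1)) = -(1 / 4) *
        ∫ t : ℝ, remainderIntegrand ν p a (k + 1) ((((1 - ν) / 2 : ℝ) : ℂ) + t * I) := fun k =>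
    componentSeries_add_remainder hν0 hν1 hp1 ha harg (by omega) (hN _ (by omega))
      (hc0 _ (by omega)) (hc1 _ (by omega)) (hcN _ (by omega)) hA0 hA1
  simp_rw [hcomp]
  refine ⟨hleft.summable, fun k hk => ?_, hright.summable, ?_⟩
  · have h1 : (1 : ℝ) ≤ N k := by exact_mod_cast hN k hk
    refine integrable_remainderIntegrand hν0 hν1 hp1 ha harg hk (N := N k) ?_
      (by linarith [hc1 k hk]) (by linarith [hc0 k hk])
    by_cases h : N k = 1
    · have := hcN k hk h
      rw [h]; push_cast; linarith
    · have h2 : (2 : ℝ) ≤ N k := by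
        have := hN k hk
        exact_mod_cast (by omega : 2 ≤ N k)
      linarith [hc1 k hk]
  · rw [besselSum, hleft.tsum_eq, hright.tsum_eq,
      integral_barnesMain_eq_residuePart hν0 hν1 hp1 ha harg hA0 hA1]
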